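/- Fix $R,Z,k>0$ with $k\ne m\pi/Z$ for all integers $m\ge 1$. Put $|k_m|=\sqrt{|k^2-m^2\pi^2/Z^2|}$ and $\kappa=\min_{m\ge1}|k_m|$. For $\chi_0>0$ let $\chi(r)=0$ for $r\le R$ and $\chi(r)=\chi_0(r-R)^2$ for $r>R$, and let $$F(r)=r+(1+\mathbf i)\chi(r),\qquad \alpha(r)=F'(r),\qquad \beta(r)=F(r)/r .$$ Let $\rho\ge 2R$, $d=\rho-R$, $\Omega_{\mathrm{pml}}=\{(r,z): R<r<\rho,\ 0<z<Z\}$ and $\Gamma_R=\{R\}\times(0,Z)$, identified with $(0,Z)$. For $\eta\in L^2(0,Z)$ let $\eta_m=\frac2Z\int_0^Z\eta(z)\sin(m\pi z/Z)\,dz$. Let $H^{1/2}_0(\Gamma_R)$ be the closure of $C_0^\infty(0,Z)$ in the norm $\|\eta\|_{H^{1/2}(\Gamma_R)}=\big(\sum_{m\ge1}m|\eta_m|^2\big)^{1/2}$, with this norm, and let $H^{-1/2}(\Gamma_R)$ be its dual with the dual norm, where a function $\xi$ acts as $\langle\xi,v\rangle=\int_0^Z\xi\bar v\,dz$. For $\eta\in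 H^{1/2}_0(\Gamma_R)$ let $w\in H^1(\Omega_{\mathrm{pml}})$ be the weak solution of $$\frac{r\beta}{\alpha}\frac{\partial}{\partial r}\Big(\frac1{r\alpha\beta}\frac{\partial w}{\partial r}\Big)+\frac{\partial^2 w}{\partial z^2}+k^2w=0\ \text{ in }\Omega_{\mathrm{pml}},\qquad w=\eta\ \text{ on }\Gamma_R,\qquad w=0\ \text{ on }\partial\Omega_{\mathrm{pml}}\setminus\Gamma_R ,$$ and let $\hat T\eta=R^2\,\frac{\partial}{\partial r}(r^{-1}w)\big|_{\Gamma_R}\in H^{-1/2}(\Gamma_R)$, understood weakly: with $$a(w,v)=\int_{\Omega_{\mathrm{pml}}}\frac1{r\beta}\Big(\frac1\alpha\frac{\partial w}{\partial r}\frac{\partial\bar v}{\partial r}+\alpha\frac{\partial w}{\partial z}\frac{\partial\bar v}{\partial z}-\alpha k^2w\bar v\Big)\,dr\,dz ,$$ $\langle\hat T\eta,\psi\rangle=-R^2a(w,\Psi)-\int_0^Z\eta\bar\psi\,dz$ for all $\psi\in H^{1/2}_0(\Gamma_R)$ and all $\Psi\in H^1(\Omega_{\mathrm{pml}})$ with $\Psi=\psi$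 on $\Gamma_R$ and $\Psi=0$ on $\partial\Omega_{\mathrm{pml}}\setminus\Gamma_R$. Then there is a constant $C>0$, depending only on $R$, $Z$ and $k$ (in particular independent of $\chi_0$ and $\rho$), such that for all $\chi_0>0$ and $\rho\ge2R$ with $\kappa\chi_0R\ge1$, $\hat T$ is a well-defined bounded linear operator $H^{1/2}_0(\Gamma_R)\to H^{-1/2}(\Gamma_R)$ and $$\|\hat T\eta\|_{H^{-1/2}(\Gamma_R)}\le C\,d^6\,|\alpha(\rho)|^4\,|\beta(\rho)|^2\,\|\eta\|_{H^{1/2}(\Gamma_R)}\qquad\text{for all }\eta\in H^{1/2}_0(\Gamma_R).$$ -/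

import Mathlib

open MeasureTheory Set
open scoped ContDiff ENNReal

noncomputable section

namespace PML

/-! ### The complex stretching of the radial coordinate -/

/-- The PML profile `χ`, equal to `0` for `r ≤ R` and to `χ₀ (r - R)²` for `r > R`. -/
def chi (χ₀ R r : ℝ) : ℝ := if r ≤ R then 0 else χ₀ * (r - R) ^ 2

/-- The stretched coordinate `F r = r + (1 + i) χ r`. -/
def stretch (χ₀ R r : ℝ) : ℂ := (r : ℂ) + (1 + Complex.I) * (chi χ₀ R r : ℂ)

/-- `α = F'`. -/
def alpha (χ₀ R r : ℝ) : ℂ := deriv (stretch χ₀ R) r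

/-- `β r = F r / r`. -/
def beta (χ₀ R r : ℝ) : ℂ := stretch χ₀ R r / (r : ℂ)

/-- `κ = min_{m ≥ 1} |k_m|`, where `k_m² = k² - m² π² / Z²`, so `|k_m| = √|k² - m² π² / Z²|`. -/
def kappa (k Z : ℝ) : ℝ :=
  ⨅ m : ℕ, Real.sqrt |k ^ 2 - ((m + 1 : ℕ) : ℝ) ^ 2 * Real.pi ^ 2 / Z ^ 2|

/-! ### The trace spaces on the interface `{R} × (0, Z)`, identified with `(0, Z)` -/

/-- `L²(0, Z)`, complex valued. -/
abbrev L2I (Z : ℝ) : Type := Lp ℂ 2 (volume.restrict (Ioo (0 : ℝ) Z))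

/-- The coefficient `f_m` of `sin (m π z / Z)` in the sine series of `f` on `(0, Z)`. -/
def sineCoeff (Z : ℝ) (m : ℕ) (f : ℝ → ℂ) : ℂ :=
  (2 / Z : ℂ) * ∫ z in Ioo (0 : ℝ) Z, f z * (Real.sin (m * Real.pi * z / Z) : ℂ)

theorem integrable_mul_sin (Z : ℝ) (m : ℕ) (f : L2I Z) :
    IntegrableOn (fun z => f z * (Real.sin (m * Real.pi * z / Z) : ℂ)) (Ioo 0 Z) := by
  have hf : IntegrableOn (fun z => f z) (Ioo 0 Z) :=
    (Lp.memLp f).integrable (by norm_num)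
  refine Integrable.mul_bdd (c := 1) hf (by fun_prop) ?_
  refine Filter.Eventually.of_forall fun z => ?_
  rw [Complex.norm_real, Real.norm_eq_abs]
  exact Real.abs_sin_le_one _

theorem sineCoeff_add (Z : ℝ) (m : ℕ) (f g : L2I Z) :
    sineCoeff Z m (f + g : L2I Z) = sineCoeff Z m f + sineCoeff Z m g := by
  unfold sineCoeff
  rw [← mul_add, ← integral_add (integrable_mul_sin Z m f) (integrable_mul_sin Z m g)]
  congr 1
  refine integral_congr_ae ?_
  filter_upwards [Lp.coeFn_add f g] with z hz
  rw [hz, Pi.add_apply, add_mul]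

theorem sineCoeff_smul (Z : ℝ) (m : ℕ) (c : ℂ) (f : L2I Z) :
    sineCoeff Z m (c • f : L2I Z) = c * sineCoeff Z m f := by
  unfold sineCoeff
  rw [mul_left_comm c, ← integral_const_mul c]
  congr 1
  refine integral_congr_ae ?_
  filter_upwards [Lp.coeFn_smul c f] with z hz
  rw [hz, Pi.smul_apply, smul_eq_mul, mul_assoc]

/-- The weighted sine coefficients `(√m f_m)`, `m ≥ 1` (the index `n` stands for `m = n + 1`). -/
def weightedCoeff (Z : ℝ) (f : L2I Z) (n : ℕ) : ℂ :=
  (Real.sqrt ((n + 1 : ℕ) : ℝ) : ℂ) * sineCoeff Z (n + 1) f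

/-- The `f ∈ L²(0, Z)` with `∑_{m ≥ 1} m |f_m|² < ∞`. -/
def sineHalfSubmodule (Z : ℝ) : Submodule ℂ (L2I Z) where
  carrier := {f | Memℓp (weightedCoeff Z f) 2}
  zero_mem' := by
    have h : weightedCoeff Z (0 : L2I Z) = 0 := by
      funext n
      have := sineCoeff_smul Z (n + 1) 0 (0 : L2I Z)
      rw [zero_smul, zero_mul] at this
      rw [weightedCoeff, this, mul_zero, Pi.zero_apply]
    simpa only [mem_ofPred_eq, h] using zero_memℓp
  add_mem' := by
    intro f g hf hg
    have h : weightedCoeff Z (f + g) = weightedCoeff Z f + weightedCoeff Z g := by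
      funext n
      simp only [weightedCoeff, sineCoeff_add, Pi.add_apply, mul_add]
    simpa only [mem_ofPred_eq, h] using hf.add hg
  smul_mem' := by
    intro c f hf
    have h : weightedCoeff Z (c • f) = c • weightedCoeff Z f := by
      funext n
      simp only [weightedCoeff, sineCoeff_smul, Pi.smul_apply, smul_eq_mul]
      ring
    simpa only [mem_ofPred_eq, h] using hf.const_smul c

/-- The space of `f ∈ L²(0, Z)` with `∑_{m ≥ 1} m |f_m|² < ∞`, as a type of its own: it carries
the norm `(∑_{m ≥ 1} m |f_m|²)^{1/2}` and not the `L²` norm. -/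
def SineHalf (Z : ℝ) : Type := sineHalfSubmodule Z

instance (Z : ℝ) : AddCommGroup (SineHalf Z) :=
  inferInstanceAs (AddCommGroup (sineHalfSubmodule Z))

instance (Z : ℝ) : Module ℂ (SineHalf Z) :=
  inferInstanceAs (Module ℂ (sineHalfSubmodule Z))

/-- The underlying element of `L²(0, Z)`. -/
def SineHalf.toL2 {Z : ℝ} (f : SineHalf Z) : L2I Z := Subtype.val f

/-- The linear map `f ↦ (√m f_m)_{m ≥ 1}` into `ℓ²`. -/
def SineHalf.toSeq (Z : ℝ) : SineHalf Z →ₗ[ℂ] lp (fun _ : ℕ => ℂ) 2 where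
  toFun f := ⟨weightedCoeff Z f.toL2, f.2⟩
  map_add' f g := by
    ext n
    change weightedCoeff Z (f.toL2 + g.toL2) n = weightedCoeff Z f.toL2 n + weightedCoeff Z g.toL2 n
    simp only [weightedCoeff, sineCoeff_add, mul_add]
  map_smul' c f := by
    ext n
    change weightedCoeff Z (c • f.toL2) n = c * weightedCoeff Z f.toL2 n
    simp only [weightedCoeff, sineCoeff_smul]
    ring

/-- `‖f‖² = ∑_{m ≥ 1} m |f_m|²`. -/
instance (Z : ℝ) : SeminormedAddCommGroup (SineHalf Z) :=
  SeminormedAddCommGroup.induced (SineHalf Z) (lp (fun _ : ℕ => ℂ) 2) (SineHalf.toSeq Z)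

instance (Z : ℝ) : NormedSpace ℂ (SineHalf Z) :=
  NormedSpace.induced ℂ (SineHalf Z) (lp (fun _ : ℕ => ℂ) 2) (SineHalf.toSeq Z)

/-- `C₀^∞(0, Z)` as a set of elements of `SineHalf Z`. -/
def testFunctions (Z : ℝ) : Set (SineHalf Z) :=
  {f | ∃ φ : ℝ → ℂ, ContDiff ℝ ∞ φ ∧ HasCompactSupport φ ∧ tsupport φ ⊆ Ioo 0 Z ∧
    f.toL2 =ᵐ[volume.restrict (Ioo 0 Z)] φ}

/-- `H^{1/2}_0`: the closure of `C₀^∞(0, Z)` in the norm `(∑_{m ≥ 1} m |f_m|²)^{1/2}`. It carries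
that norm. -/
def HHalf (Z : ℝ) : Type :=
  (Submodule.span ℂ (testFunctions Z)).topologicalClosure

instance (Z : ℝ) : SeminormedAddCommGroup (HHalf Z) :=
  inferInstanceAs (SeminormedAddCommGroup (Submodule.span ℂ (testFunctions Z)).topologicalClosure)

instance (Z : ℝ) : NormedSpace ℂ (HHalf Z) :=
  inferInstanceAs (NormedSpace ℂ (Submodule.span ℂ (testFunctions Z)).topologicalClosure)

/-- The function on `(0, Z)` represented by an element of `H^{1/2}_0`. -/
def HHalf.fn {Z : ℝ} (η : HHalf Z) : ℝ → ℂ := ⇑(Subtype.val η : SineHalf Z).toL2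

/-- `H^{-1/2}`: the dual space of `H^{1/2}_0` with the dual norm. Its elements `ξ` are the bounded
antilinear functionals `v ↦ ⟨ξ, v⟩`, a function `ξ` acting as `⟨ξ, v⟩ = ∫ ξ conj(v) dz`. -/
abbrev HNegHalf (Z : ℝ) : Type := HHalf Z →L⋆[ℂ] ℂ

/-! ### The Dirichlet problem in the PML and its Dirichlet-to-Neumann map -/

/-- The PML region `(R, ρ) × (0, Z)`, in the coordinates `(r, z)`. -/
def pmlRegion (R ρ Z : ℝ) : Set (ℝ × ℝ) := Ioo R ρ ×ˢ Ioo 0 Z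

/-- `w ∈ H¹` of the PML region, with weak partial derivatives `wr = ∂w/∂r` and `wz = ∂w/∂z`, and
the trace of `w` is `g` on `{R} × (0, Z)` and `0` on the rest of the boundary. Weak derivatives and
traces are expressed together by Green's formulas against all functions that are smooth up to the
boundary; those supported in the open region give the weak derivatives. -/
structure HasDirichletTrace (R ρ Z : ℝ) (w wr wz : ℝ × ℝ → ℂ) (g : ℝ → ℂ) : Prop where
  memLp : MemLp w 2 (volume.restrict (pmlRegion R ρ Z))
  memLp_r : MemLp wr 2 (volume.restrict (pmlRegion R ρ Z))
  memLp_z : MemLp wz 2 (volume.restrict (pmlRegion R ρ Z))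
  green_r : ∀ φ : ℝ × ℝ → ℂ, ContDiff ℝ ∞ φ →
    ∫ x in pmlRegion R ρ Z, (w x * fderiv ℝ φ x (1, 0) + wr x * φ x)
      = -∫ z in Ioo 0 Z, g z * φ (R, z)
  green_z : ∀ φ : ℝ × ℝ → ℂ, ContDiff ℝ ∞ φ →
    ∫ x in pmlRegion R ρ Z, (w x * fderiv ℝ φ x (0, 1) + wz x * φ x) = 0

/-- The sesquilinear form of the PML equation,
`∫ (1 / (r β)) (α⁻¹ w_r conj(v_r) + α w_z conj(v_z) - α k² w conj(v)) dr dz`. -/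
def aPML (k χ₀ R ρ Z : ℝ) (w wr wz v vr vz : ℝ × ℝ → ℂ) : ℂ :=
  ∫ x in pmlRegion R ρ Z,
    (1 / ((x.1 : ℂ) * beta χ₀ R x.1)) *
      ((alpha χ₀ R x.1)⁻¹ * wr x * star (vr x) + alpha χ₀ R x.1 * wz x * star (vz x)
        - alpha χ₀ R x.1 * (k : ℂ) ^ 2 * w x * star (v x))

/-- `w ∈ H¹` is a weak solution of
`(r β / α) ∂_r ((r α β)⁻¹ ∂_r w) + ∂_z² w + k² w = 0` in the PML region, `w = g` on
`{R} × (0, Z)` and `w = 0` on the rest of the boundary. The test functions `v` range over `H¹₀`. -/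
structure IsPMLSolution (k χ₀ R ρ Z : ℝ) (g : ℝ → ℂ) (w wr wz : ℝ × ℝ → ℂ) : Prop where
  trace : HasDirichletTrace R ρ Z w wr wz g
  weak : ∀ v vr vz : ℝ × ℝ → ℂ, HasDirichletTrace R ρ Z v vr vz (fun _ => 0) →
    aPML k χ₀ R ρ Z w wr wz v vr vz = 0

/-- `ℓ = R² ∂_r (r⁻¹ w)` on `{R} × (0, Z)`, as an element of `H^{-1/2}`, for a weak solution `w`
with `w = η` on `{R} × (0, Z)`.

Since `α = β = 1` at `r = R`, `R² ∂_r (r⁻¹ w) = R² (r α β)⁻¹ ∂_r w - w` there. The first term is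
the normal component of the field `((r α β)⁻¹ w_r, α (r β)⁻¹ w_z)`, whose divergence is
`-k² α (r β)⁻¹ w`. It is given by Green's formula, the normal `(-1, 0)` pointing out of the PML
region: `⟨(r α β)⁻¹ ∂_r w, ψ⟩ = -aPML (w, Ψ)` whenever `Ψ ∈ H¹` has trace `ψ` on `{R} × (0, Z)` and
`0` on the rest of the boundary. -/
def IsNeumannTrace (k χ₀ R ρ Z : ℝ) (η : HHalf Z) (w wr wz : ℝ × ℝ → ℂ) (ℓ : HNegHalf Z) : Prop :=
  ∀ (ψ : HHalf Z) (Ψ Ψr Ψz : ℝ × ℝ → ℂ), HasDirichletTrace R ρ Z Ψ Ψr Ψz ψ.fn →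
    ℓ ψ = -(R : ℂ) ^ 2 * aPML k χ₀ R ρ Z w wr wz Ψ Ψr Ψz
      - ∫ z in Ioo 0 Z, η.fn z * star (ψ.fn z)

/-- The relation `ℓ = T̂ η`: `ℓ = R² ∂_r (r⁻¹ w)` on `{R} × (0, Z)` for a solution `w` of the
Dirichlet problem in the PML with data `η`. -/
def IsPMLDtN (k χ₀ R ρ Z : ℝ) (η : HHalf Z) (ℓ : HNegHalf Z) : Prop :=
  ∃ w wr wz : ℝ × ℝ → ℂ,
    IsPMLSolution k χ₀ R ρ Z η.fn w wr wz ∧ IsNeumannTrace k χ₀ R ρ Z η w wr wz ℓ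

end PML

end

noncomputable section

namespace PML

/-! Sine series in z diagonalise the problem. With F = rβ and q = k² - m²π²/Z², the m-th coefficient
of the solution is η_m w, where w' = αF p, p' = -q (α/F) w, w(R) = 1 and w(ρ) = 0. Since αF = R at r
= R, T̂ multiplies η_m by R² p(R) - 1. In the given norms everything reduces to |p(R)| ≤ C m |α(ρ)|⁴
with C independent of m, χ₀ and ρ (`exists_mode_bound`). This is more than the theorem asks, because
d ≥ R and |β(ρ)| ≥ 1.

The mode bound rests on the flux identity (p w̄)' = conj(αF)|p|² - q (α/F)|w|². On r ≥ R both αF and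
α/F lie in the closed first quadrant, so the real part is definite when q ≤ 0 and the imaginary part
when q ≥ 0. Integrated over (R, ρ), either energy is at most |p(R)|. Conversely, a cutoff near R
writes p(R) as an integral of w and p (`norm_p_le`). Young's inequality bounds this integral by a
constant plus a fraction below one of |p(R)|, which is absorbed. For q ≤ 0 the p-part of the real
energy is coercive up to r = R, and a layer of thickness R/m gives linear growth in m
(`evanescent_bound`). For q > 0 the imaginary energy degenerates like r - R at the interface. The
loss is repaired by a Hardy inequality (`hardy`), and κχ₀R ≥ 1 supplies χ₀ ≥ 1/(κR) alongside q ≥ κ²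
(`propagating_bound`).

Summing the modes in L² gives a solution and a formula for its form against every function with a
Dirichlet trace (`exists_modal_solution`). That T̂η does not depend on the solution chosen follows
from the symmetry of the form (`aPML_star_swap`): the test function is taken to be the conjugate of
a modal solution with conjugate data. -/

/-! ### Linear ordinary differential equations on the whole line. -/

/-- Global solvability of linear ordinary differential equations. -/
theorem exists_linear_ode {E : Type*} [NormedAddCommGroup E] [NormedSpace ℝ E] [CompleteSpace E]
    (A : ℝ → E →L[ℝ] E) (hA : Continuous A) (t₀ : ℝ) (x₀ : E) :
    ∃ x : ℝ → E, x t₀ = x₀ ∧ ∀ t, HasDerivAt x (A t (x t)) t := by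
  set N : ℝ → ℝ := fun t => ∫ s in t₀..t, ‖A s‖ with hN
  have hNd : ∀ t, HasDerivAt N ‖A t‖ t := fun t =>
    (hA.norm.integral_hasStrictDerivAt t₀ t).hasDerivAt
  have hNc : Continuous N := continuous_iff_continuousAt.2 fun t => (hNd t).continuousAt
  -- Picard iteration becomes a contraction after division by this weight: ∫ ‖A‖ cosh(2N) =
  -- sinh(2N)/2 is at most half the weight in absolute value. The even function cosh serves both
  -- time directions, since N changes sign at t₀.
  set wt : ℝ → ℝ := fun t => Real.cosh (2 * N t) with hwt
  have hwtc : Continuous wt := by fun_prop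
  have hwtpos : ∀ t, 0 < wt t := fun t => Real.cosh_pos _
  have hwt1 : ∀ t, 1 ≤ wt t := fun t => Real.one_le_cosh _
  have hkey : ∀ t, |∫ s in t₀..t, ‖A s‖ * wt s| ≤ wt t / 2 := by
    intro t
    have h : ∫ s in t₀..t, ‖A s‖ * wt s
        = Real.sinh (2 * N t) / 2 - Real.sinh (2 * N t₀) / 2 := by
      refine intervalIntegral.integral_eq_sub_of_hasDerivAt
        (f := fun t => Real.sinh (2 * N t) / 2) (fun s _ => ?_)
        (by apply Continuous.intervalIntegrable; fun_prop)
      convert! (((hNd s).const_mul 2).sinh).div_const 2 using 1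
      simp only [hwt]; ring
    have h0 : N t₀ = 0 := by simp [hN]
    rw [h, h0]
    simp only [mul_zero, Real.sinh_zero, zero_div, sub_zero, abs_div, abs_two]
    gcongr
    rw [Real.abs_sinh, hwt]
    change _ ≤ Real.cosh _
    rw [← Real.cosh_abs]
    exact (Real.sinh_lt_cosh _).le
  have hint : ∀ y : BoundedContinuousFunction ℝ E,
      Continuous fun s => A s (wt s • y s) := fun y => hA.clm_apply (hwtc.smul y.continuous)
  have hbd : ∀ (u : ℝ → E) (K : ℝ), (∀ s, ‖u s‖ ≤ K) → ∀ t,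
      ‖∫ s in t₀..t, A s (wt s • u s)‖ ≤ K * wt t / 2 := by
    intro u K hu t
    have hK : 0 ≤ K := (norm_nonneg _).trans (hu 0)
    have h1 : ‖∫ s in t₀..t, A s (wt s • u s)‖ ≤ |∫ s in t₀..t, K * (‖A s‖ * wt s)| := by
      refine intervalIntegral.norm_integral_le_abs_of_norm_le
        (Filter.Eventually.of_forall fun s => ?_)
        (by apply Continuous.intervalIntegrable; fun_prop)
      refine ((A s).le_opNorm _).trans ?_
      rw [norm_smul, Real.norm_of_nonneg (hwtpos s).le]
      have := mul_le_mul_of_nonneg_left (hu s) (mul_nonneg (norm_nonneg (A s)) (hwtpos s).le)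
      linarith
    rw [intervalIntegral.integral_const_mul, abs_mul, abs_of_nonneg hK] at h1
    have := mul_le_mul_of_nonneg_left (hkey t) hK
    linarith
  have hcont : ∀ y : BoundedContinuousFunction ℝ E,
      Continuous fun t => (wt t)⁻¹ • (x₀ + ∫ s in t₀..t, A s (wt s • y s)) := by
    intro y
    refine (hwtc.inv₀ fun t => (hwtpos t).ne').smul (continuous_const.add ?_)
    exact intervalIntegral.continuous_primitive (fun a b => (hint y).intervalIntegrable a b) t₀
  let T : BoundedContinuousFunction ℝ E → BoundedContinuousFunction ℝ E := fun y =>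
    BoundedContinuousFunction.ofNormedAddCommGroup _ (hcont y) (‖x₀‖ + ‖y‖ / 2) (by
      intro t
      rw [norm_smul, norm_inv, Real.norm_of_nonneg (hwtpos t).le, inv_mul_le_iff₀ (hwtpos t)]
      refine (norm_add_le _ _).trans ?_
      have h1 := hbd y ‖y‖ y.norm_coe_le_norm t
      have h2 := mul_le_mul_of_nonneg_right (hwt1 t) (norm_nonneg x₀)
      linarith)
  have hTapp : ∀ y t, T y t = (wt t)⁻¹ • (x₀ + ∫ s in t₀..t, A s (wt s • y s)) := fun _ _ => rfl
  have hT : ContractingWith (1 / 2) T := by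
    refine ⟨by rw [div_lt_one] <;> norm_num, LipschitzWith.of_dist_le_mul fun y z => ?_⟩
    rw [BoundedContinuousFunction.dist_le (by positivity)]
    intro t
    rw [hTapp, hTapp, dist_eq_norm, ← smul_sub, add_sub_add_left_eq_sub,
      ← intervalIntegral.integral_sub ((hint y).intervalIntegrable _ _)
        ((hint z).intervalIntegrable _ _), norm_smul, norm_inv, Real.norm_of_nonneg (hwtpos t).le,
      inv_mul_le_iff₀ (hwtpos t)]
    simp only [← map_sub, ← smul_sub]
    refine (hbd (fun s => y s - z s) (dist y z) (fun s => ?_) t).trans (le_of_eq ?_)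
    · rw [← dist_eq_norm]; exact BoundedContinuousFunction.dist_coe_le_dist s
    · push_cast; ring
  set y := hT.fixedPoint T with hy
  have hfix : T y = y := hT.fixedPoint_isFixedPt
  have hx : ∀ t, wt t • y t = x₀ + ∫ s in t₀..t, A s (wt s • y s) := by
    intro t
    conv_lhs => rw [← hfix, hTapp, smul_smul, mul_inv_cancel₀ (hwtpos t).ne', one_smul]
  refine ⟨fun t => wt t • y t, by simpa using hx t₀, fun t => ?_⟩
  have h := ((hint y).integral_hasStrictDerivAt t₀ t).hasDerivAt.const_add x₀
  exact h.congr_of_eventuallyEq (Filter.Eventually.of_forall hx)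

/-- Global smooth solutions of a first order system `w' = a p`, `p' = b w`. -/
theorem exists_smooth_system (a b : ℝ → ℂ) (ha : ContDiff ℝ ∞ a) (hb : ContDiff ℝ ∞ b)
    (t₀ : ℝ) (w₀ p₀ : ℂ) :
    ∃ w p : ℝ → ℂ, w t₀ = w₀ ∧ p t₀ = p₀ ∧ ContDiff ℝ ∞ w ∧ ContDiff ℝ ∞ p ∧
      (∀ t, HasDerivAt w (a t * p t) t) ∧ ∀ t, HasDerivAt p (b t * w t) t := by
  let L₁ : ℂ × ℂ →L[ℂ] ℂ × ℂ :=
    (ContinuousLinearMap.inl ℂ ℂ ℂ).comp (ContinuousLinearMap.snd ℂ ℂ ℂ)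
  let L₂ : ℂ × ℂ →L[ℂ] ℂ × ℂ :=
    (ContinuousLinearMap.inr ℂ ℂ ℂ).comp (ContinuousLinearMap.fst ℂ ℂ ℂ)
  let A : ℝ → ℂ × ℂ →L[ℝ] ℂ × ℂ := fun t =>
    a t • L₁.restrictScalars ℝ + b t • L₂.restrictScalars ℝ
  have hac := ha.continuous
  have hbc := hb.continuous
  obtain ⟨x, hx0, hx⟩ := exists_linear_ode A (by fun_prop) t₀ (w₀, p₀)
  have hAx : ∀ t, A t (x t) = (a t * (x t).2, b t * (x t).1) := by
    intro t; simp [A, L₁, L₂]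
  have hw : ∀ t, HasDerivAt (fun t => (x t).1) (a t * (x t).2) t := by
    intro t
    have h := (hasFDerivAt_fst (𝕜 := ℝ) (p := x t)).comp_hasDerivAt t (hx t)
    rw [hAx] at h; exact h
  have hp : ∀ t, HasDerivAt (fun t => (x t).2) (b t * (x t).1) t := by
    intro t
    have h := (hasFDerivAt_snd (𝕜 := ℝ) (p := x t)).comp_hasDerivAt t (hx t)
    rw [hAx] at h; exact h
  -- Bootstrapping: each derivative is a smooth coefficient times the other component.
  have hsm : ∀ n : ℕ, ContDiff ℝ n (fun t => (x t).1) ∧ ContDiff ℝ n (fun t => (x t).2) := by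
    intro n
    induction n with
    | zero =>
      simp only [Nat.cast_zero, contDiff_zero]
      exact ⟨continuous_iff_continuousAt.2 fun t => (hw t).continuousAt,
        continuous_iff_continuousAt.2 fun t => (hp t).continuousAt⟩
    | succ n ih =>
      have hn : (n : WithTop ℕ∞) ≤ (∞ : WithTop ℕ∞) := by exact_mod_cast le_top
      have e1 : deriv (fun t => (x t).1) = fun t => a t * (x t).2 := funext fun t => (hw t).deriv
      have e2 : deriv (fun t => (x t).2) = fun t => b t * (x t).1 := funext fun t => (hp t).deriv
      push_cast
      rw [contDiff_succ_iff_deriv, contDiff_succ_iff_deriv, e1, e2]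
      exact ⟨⟨fun t => (hw t).differentiableAt, by simp, (ha.of_le hn).mul ih.2⟩,
        ⟨fun t => (hp t).differentiableAt, by simp, (hb.of_le hn).mul ih.1⟩⟩
  exact ⟨_, _, by simp [hx0], by simp [hx0], contDiff_infty.2 fun n => (hsm n).1,
    contDiff_infty.2 fun n => (hsm n).2, hw, hp⟩

/-! ### Sine series on (0, Z): orthogonality, completeness, Parseval. -/

theorem integral_cos_nat {Z : ℝ} (hZ : 0 < Z) {j : ℤ} (hj : j ≠ 0) :
    ∫ z in Ioo 0 Z, Real.cos (j * Real.pi * z / Z) = 0 := by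
  rw [← integral_Ioc_eq_integral_Ioo, ← intervalIntegral.integral_of_le hZ.le]
  have hc : (j : ℝ) * Real.pi / Z ≠ 0 := by
    have : (j : ℝ) ≠ 0 := by exact_mod_cast hj
    have := Real.pi_ne_zero
    positivity
  have h : ∀ z, Real.cos (j * Real.pi * z / Z) = Real.cos ((j * Real.pi / Z) * z) := by
    intro z; congr 1; ring
  simp_rw [h]
  rw [intervalIntegral.integral_comp_mul_left (fun z => Real.cos z) hc, integral_cos]
  have : (j : ℝ) * Real.pi / Z * Z = j * Real.pi := by field_simp
  rw [this, Real.sin_int_mul_pi]; simp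

theorem integrableOn_of_continuous {Z : ℝ} {f : ℝ → ℝ} (hf : Continuous f) :
    IntegrableOn f (Ioo 0 Z) :=
  (hf.integrableOn_Icc (a := 0) (b := Z)).mono_set Ioo_subset_Icc_self

theorem integral_sin_mul_sin {Z : ℝ} (hZ : 0 < Z) (m n : ℕ) :
    ∫ z in Ioo 0 Z, Real.sin ((m + 1 : ℕ) * Real.pi * z / Z)
        * Real.sin ((n + 1 : ℕ) * Real.pi * z / Z) = if m = n then Z / 2 else 0 := by
  have h : ∀ z, Real.sin ((m + 1 : ℕ) * Real.pi * z / Z) * Real.sin ((n + 1 : ℕ) * Real.pi * z / Z)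
      = (Real.cos (((m - n : ℤ) : ℝ) * Real.pi * z / Z)
        - Real.cos (((m + n + 2 : ℤ) : ℝ) * Real.pi * z / Z)) / 2 := by
    intro z
    have e1 : ((m - n : ℤ) : ℝ) * Real.pi * z / Z
        = (m + 1 : ℕ) * Real.pi * z / Z - (n + 1 : ℕ) * Real.pi * z / Z := by push_cast; ring
    have e2 : ((m + n + 2 : ℤ) : ℝ) * Real.pi * z / Z
        = (m + 1 : ℕ) * Real.pi * z / Z + (n + 1 : ℕ) * Real.pi * z / Z := by push_cast; ring
    rw [e1, e2, Real.cos_sub, Real.cos_add]; ring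
  simp_rw [h]
  rw [integral_div, integral_sub (integrableOn_of_continuous (by fun_prop))
    (integrableOn_of_continuous (by fun_prop)), integral_cos_nat hZ (j := m + n + 2) (by omega)]
  split_ifs with hmn
  · subst hmn; simp [hZ.le]
  · rw [integral_cos_nat hZ (by omega)]; simp

theorem integral_cos_mul_cos {Z : ℝ} (hZ : 0 < Z) (m n : ℕ) :
    ∫ z in Ioo 0 Z, Real.cos ((m + 1 : ℕ) * Real.pi * z / Z)
        * Real.cos ((n + 1 : ℕ) * Real.pi * z / Z) = if m = n then Z / 2 else 0 := by
  have h : ∀ z, Real.cos ((m + 1 : ℕ) * Real.pi * z / Z) * Real.cos ((n + 1 : ℕ) * Real.pi * z / Z)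
      = (Real.cos (((m - n : ℤ) : ℝ) * Real.pi * z / Z)
        + Real.cos (((m + n + 2 : ℤ) : ℝ) * Real.pi * z / Z)) / 2 := by
    intro z
    have e1 : ((m - n : ℤ) : ℝ) * Real.pi * z / Z
        = (m + 1 : ℕ) * Real.pi * z / Z - (n + 1 : ℕ) * Real.pi * z / Z := by push_cast; ring
    have e2 : ((m + n + 2 : ℤ) : ℝ) * Real.pi * z / Z
        = (m + 1 : ℕ) * Real.pi * z / Z + (n + 1 : ℕ) * Real.pi * z / Z := by push_cast; ring
    rw [e1, e2, Real.cos_sub, Real.cos_add]; ring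
  simp_rw [h]
  rw [integral_div, integral_add (integrableOn_of_continuous (by fun_prop))
    (integrableOn_of_continuous (by fun_prop)), integral_cos_nat hZ (j := m + n + 2) (by omega)]
  split_ifs with hmn
  · subst hmn; simp [hZ.le]
  · rw [integral_cos_nat hZ (by omega)]; simp

/-- A square integrable function with vanishing sine coefficients is zero. -/
theorem ae_eq_zero_of_sineCoeff {Z : ℝ} (hZ : 0 < Z) {f : ℝ → ℂ}
    (hf : MemLp f 2 (volume.restrict (Ioo 0 Z))) (h0 : ∀ n : ℕ, sineCoeff Z (n + 1) f = 0) :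
    f =ᵐ[volume.restrict (Ioo 0 Z)] 0 := by
  have hZZ : -Z < Z := by linarith
  set g : ℝ → ℂ := (Ioo 0 Z).indicator f with hg
  have hgL : MemLp g 2 volume := (memLp_indicator_iff_restrict measurableSet_Ioo).2 hf
  have hgn : MemLp (fun x => g (-x)) 2 volume :=
    hgL.comp_measurePreserving (Measure.measurePreserving_neg volume)
  -- The odd extension of f to (-Z, Z). Its Fourier coefficients for the period 2Z are multiples of
  -- the sine coefficients of f, so Parseval's identity for Fourier series makes it vanish.
  set u : ℝ → ℂ := fun x => g x - g (-x) with hu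
  have huL : MemLp u 2 volume := hgL.sub hgn
  have hgi : ∀ v : ℝ → ℂ, Continuous v →
      IntervalIntegrable (fun x => v x * g x) volume (-Z) Z := by
    intro v hv
    have : IntervalIntegrable g volume (-Z) Z := by
      rw [intervalIntegrable_iff_integrableOn_Ioc_of_le hZZ.le]
      exact (hgL.restrict _).integrable (by norm_num)
    exact this.continuousOn_mul hv.continuousOn
  have hsin : ∀ n : ℤ, ∫ x in (-Z)..Z, (Real.sin (n * Real.pi * x / Z) : ℂ) * g x = 0 := by
    have hnat : ∀ n : ℕ, ∫ x in (-Z)..Z, (Real.sin (n * Real.pi * x / Z) : ℂ) * g x = 0 := by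
      intro n
      rcases n with _ | n
      · simp
      have h1 := h0 n
      unfold sineCoeff at h1
      have h2 : (2 / Z : ℂ) ≠ 0 := by
        have : (Z : ℂ) ≠ 0 := by exact_mod_cast hZ.ne'
        simp [this]
      rw [mul_eq_zero, or_iff_right h2] at h1
      rw [intervalIntegral.integral_of_le hZZ.le, ← h1, ← integral_indicator measurableSet_Ioc,
        ← integral_indicator measurableSet_Ioo]
      congr 1
      ext x
      by_cases hx : x ∈ Ioo 0 Z
      · have hx' : x ∈ Ioc (-Z) Z := ⟨by linarith [hx.1], hx.2.le⟩
        simp only [indicator_of_mem hx, indicator_of_mem hx', hg]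
        push_cast; ring
      · rw [indicator_of_notMem hx]
        by_cases hx' : x ∈ Ioc (-Z) Z
        · rw [indicator_of_mem hx', hg, indicator_of_notMem hx, mul_zero]
        · rw [indicator_of_notMem hx']
    intro n
    obtain ⟨k, rfl | rfl⟩ := n.eq_nat_or_neg
    · exact_mod_cast hnat k
    · have := hnat k
      rw [← neg_eq_zero, ← intervalIntegral.integral_neg] at this
      rw [← this]
      congr 1; ext x
      have : ((-(k : ℤ) : ℤ) : ℝ) * Real.pi * x / Z = -(k * Real.pi * x / Z) := by push_cast; ring
      rw [this, Real.sin_neg]; push_cast; ring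
  have hcoef : ∀ n : ℤ, fourierCoeffOn hZZ u n = 0 := by
    intro n
    have hfx : ∀ x : ℝ, fourier (-n) (x : AddCircle (Z - -Z))
        = Complex.exp (-(n * Real.pi * x / Z : ℝ) * Complex.I) := by
      intro x
      rw [fourier_coe_apply]
      congr 1
      have : (Z : ℂ) ≠ 0 := by exact_mod_cast hZ.ne'
      push_cast
      field_simp
      ring
    rw [fourierCoeffOn_eq_integral]
    have hsplit : ∫ x in (-Z)..Z, fourier (-n) (x : AddCircle (Z - -Z)) • u x
        = (∫ x in (-Z)..Z, Complex.exp (-(n * Real.pi * x / Z : ℝ) * Complex.I) * g x)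
          - ∫ x in (-Z)..Z, Complex.exp ((n * Real.pi * x / Z : ℝ) * Complex.I) * g x := by
      have h2 : ∫ x in (-Z)..Z, Complex.exp ((n * Real.pi * x / Z : ℝ) * Complex.I) * g x
          = ∫ x in (-Z)..Z, Complex.exp (-(n * Real.pi * x / Z : ℝ) * Complex.I) * g (-x) := by
        rw [← neg_neg Z, ← intervalIntegral.integral_comp_neg, neg_neg]
        congr 1; ext x; congr 2; push_cast; ring
      have h3 : IntervalIntegrable
          (fun x => Complex.exp (-(n * Real.pi * x / Z : ℝ) * Complex.I) * g (-x)) volume (-Z) Z := by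
        have : IntervalIntegrable (fun x => g (-x)) volume (-Z) Z := by
          rw [intervalIntegrable_iff_integrableOn_Ioc_of_le hZZ.le]
          exact (hgn.restrict _).integrable (by norm_num)
        exact this.continuousOn_mul (by fun_prop)
      rw [h2, ← intervalIntegral.integral_sub (hgi _ (by fun_prop)) h3]
      congr 1; ext x
      rw [hfx, hu, smul_eq_mul]; ring
    rw [hsplit, ← intervalIntegral.integral_sub (hgi _ (by fun_prop)) (hgi _ (by fun_prop))]
    have h4 : ∀ x : ℝ, Complex.exp (-(n * Real.pi * x / Z : ℝ) * Complex.I) * g x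
        - Complex.exp ((n * Real.pi * x / Z : ℝ) * Complex.I) * g x
        = (-2 * Complex.I) * ((Real.sin (n * Real.pi * x / Z) : ℂ) * g x) := by
      intro x
      rw [Complex.exp_mul_I, Complex.exp_mul_I, Complex.cos_neg, Complex.sin_neg,
        Complex.ofReal_sin]
      ring
    simp_rw [h4]
    rw [intervalIntegral.integral_const_mul, hsin n]
    simp
  have hP := hasSum_sq_fourierCoeffOn hZZ (huL.restrict _)
  simp only [hcoef, norm_zero, ne_eq, OfNat.ofNat_ne_zero, not_false_eq_true, zero_pow] at hP
  have hP0 := hP.unique hasSum_zero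
  rw [smul_eq_zero, or_iff_right (inv_ne_zero (by linarith)),
    intervalIntegral.integral_of_le hZZ.le] at hP0
  rw [integral_eq_zero_iff_of_nonneg (fun x => by positivity)
    ((huL.restrict _).integrable_norm_pow (by norm_num))] at hP0
  have h5 : ∀ᵐ x ∂(volume.restrict (Ioo 0 Z)), ‖u x‖ ^ 2 = 0 :=
    ae_restrict_of_ae_restrict_of_subset
      (fun x hx => ⟨by linarith [hx.1], hx.2.le⟩ : Ioo 0 Z ⊆ Ioc (-Z) Z) hP0
  filter_upwards [h5, ae_restrict_mem measurableSet_Ioo] with x hx hxm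
  have h6 : g (-x) = 0 := indicator_of_notMem (fun h => by linarith [h.1, hxm.1]) _
  have h7 : g x = f x := indicator_of_mem hxm _
  simpa [hu, h6, h7] using hx

/-- The normalised sine functions. -/
def sineLp (Z : ℝ) (n : ℕ) : L2I Z :=
  MemLp.toLp (fun z => ((Real.sqrt (2 / Z) * Real.sin ((n + 1 : ℕ) * Real.pi * z / Z) : ℝ) : ℂ))
    (MemLp.of_bound (by fun_prop) (Real.sqrt (2 / Z)) (Filter.Eventually.of_forall fun z => by
      rw [Complex.norm_real, Real.norm_eq_abs, abs_mul, abs_of_nonneg (Real.sqrt_nonneg _)]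
      exact mul_le_of_le_one_right (Real.sqrt_nonneg _) (Real.abs_sin_le_one _)))

theorem coeFn_sineLp (Z : ℝ) (n : ℕ) : sineLp Z n =ᵐ[volume.restrict (Ioo 0 Z)]
    fun z => ((Real.sqrt (2 / Z) * Real.sin ((n + 1 : ℕ) * Real.pi * z / Z) : ℝ) : ℂ) :=
  MemLp.coeFn_toLp _

theorem inner_sineLp {Z : ℝ} (hZ : 0 < Z) (n : ℕ) (f : L2I Z) :
    inner ℂ (sineLp Z n) f = (Real.sqrt (Z / 2) : ℂ) * sineCoeff Z (n + 1) f := by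
  have hs : (Real.sqrt (2 / Z) : ℂ) = (Real.sqrt (Z / 2) : ℂ) * (2 / Z) := by
    have : Real.sqrt (2 / Z) = Real.sqrt (Z / 2) * (2 / Z) := by
      rw [Real.sqrt_eq_iff_eq_sq (by positivity) (by positivity), mul_pow,
        Real.sq_sqrt (by positivity)]
      field_simp
    rw [this]; push_cast; rfl
  rw [L2.inner_def, sineCoeff, ← mul_assoc, ← hs, ← integral_const_mul]
  refine integral_congr_ae ?_
  filter_upwards [coeFn_sineLp Z n] with z hz
  rw [hz, RCLike.inner_apply, Complex.conj_ofReal]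
  push_cast; ring

theorem orthonormal_sineLp {Z : ℝ} (hZ : 0 < Z) : Orthonormal ℂ (sineLp Z) := by
  rw [orthonormal_iff_ite]
  intro m n
  have h : inner ℂ (sineLp Z m) (sineLp Z n) = ((2 / Z * ∫ z in Ioo 0 Z,
      Real.sin ((m + 1 : ℕ) * Real.pi * z / Z) * Real.sin ((n + 1 : ℕ) * Real.pi * z / Z) : ℝ)
        : ℂ) := by
    rw [L2.inner_def, ← integral_const_mul, ← integral_complex_ofReal]
    refine integral_congr_ae ?_
    filter_upwards [coeFn_sineLp Z m, coeFn_sineLp Z n] with z hz hz'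
    rw [hz, hz', RCLike.inner_apply, Complex.conj_ofReal, ← Complex.ofReal_mul]
    congr 1
    have := Real.mul_self_sqrt (show 0 ≤ 2 / Z by positivity)
    linear_combination (Real.sin ((m + 1 : ℕ) * Real.pi * z / Z)
      * Real.sin ((n + 1 : ℕ) * Real.pi * z / Z)) * this
  rw [h, integral_sin_mul_sin hZ]
  split_ifs
  · norm_cast; field_simp
  · simp

theorem sineCoeff_congr {Z : ℝ} {m : ℕ} {f g : ℝ → ℂ}
    (h : f =ᵐ[volume.restrict (Ioo 0 Z)] g) : sineCoeff Z m f = sineCoeff Z m g := by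
  unfold sineCoeff
  congr 1
  refine integral_congr_ae ?_
  filter_upwards [h] with z hz
  rw [hz]

theorem sineCoeff_star {Z : ℝ} (m : ℕ) (f : ℝ → ℂ) :
    sineCoeff Z m (fun z => star (f z)) = star (sineCoeff Z m f) := by
  unfold sineCoeff
  simp only [star_mul', Complex.star_def, map_div₀, Complex.conj_ofReal, ← integral_conj, map_mul,
    map_ofNat]

/-- Parseval's identity for sine series, in bilinear form. -/
theorem hasSum_sineCoeff_mul {Z : ℝ} (hZ : 0 < Z) {g h : ℝ → ℂ}
    (hg : MemLp g 2 (volume.restrict (Ioo 0 Z))) (hh : MemLp h 2 (volume.restrict (Ioo 0 Z))) :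
    HasSum (fun n : ℕ => (Z / 2 : ℂ) * (sineCoeff Z (n + 1) g * sineCoeff Z (n + 1) h))
      (∫ z in Ioo 0 Z, g z * h z) := by
  have hperp : (Submodule.span ℂ (range (sineLp Z)))ᗮ = ⊥ := by
    rw [Submodule.eq_bot_iff]
    intro f hf
    rw [Submodule.mem_orthogonal] at hf
    have h0 : ∀ n : ℕ, sineCoeff Z (n + 1) f = 0 := by
      intro n
      have h1 := hf (sineLp Z n) (Submodule.subset_span ⟨n, rfl⟩)
      rw [inner_sineLp hZ, mul_eq_zero] at h1
      refine h1.resolve_left ?_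
      have : Real.sqrt (Z / 2) ≠ 0 := (Real.sqrt_pos.2 (by positivity)).ne'
      exact_mod_cast this
    exact (Lp.eq_zero_iff_ae_eq_zero).2 (ae_eq_zero_of_sineCoeff hZ (Lp.memLp f) h0)
  let b := HilbertBasis.mkOfOrthogonalEqBot (orthonormal_sineLp hZ) hperp
  have hb : ∀ n, b n = sineLp Z n := fun n => by
    simp [b, HilbertBasis.coe_mkOfOrthogonalEqBot]
  -- Parseval for the Hilbert basis is sesquilinear; conjugating g makes it bilinear.
  have hgs : MemLp (fun z => star (g z)) 2 (volume.restrict (Ioo 0 Z)) := hg.star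
  have key := b.hasSum_inner_mul_inner (hgs.toLp _) (hh.toLp _)
  have e1 : inner ℂ (hgs.toLp _) (hh.toLp _) = ∫ z in Ioo 0 Z, g z * h z := by
    rw [L2.inner_def]
    refine integral_congr_ae ?_
    filter_upwards [hgs.coeFn_toLp, hh.coeFn_toLp] with z hz hz'
    rw [hz, hz', RCLike.inner_apply]
    simp [mul_comm]
  rw [e1] at key
  suffices h : ∀ n : ℕ, (Z / 2 : ℂ) * (sineCoeff Z (n + 1) g * sineCoeff Z (n + 1) h)
      = inner ℂ (hgs.toLp _) (b n) * inner ℂ (b n) (hh.toLp _) by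
    simp only [h]; exact key
  intro n
  rw [← inner_conj_symm, hb, inner_sineLp hZ, inner_sineLp hZ, sineCoeff_congr hgs.coeFn_toLp,
    sineCoeff_congr hh.coeFn_toLp, sineCoeff_star]
  have : (Real.sqrt (Z / 2) : ℂ) * (Real.sqrt (Z / 2) : ℂ) = Z / 2 := by
    rw [← Complex.ofReal_mul, Real.mul_self_sqrt (by positivity)]; push_cast; rfl
  rw [← this]
  simp only [map_mul, Complex.conj_ofReal, Complex.star_def, Complex.conj_conj]
  ring

/-! ### Sign and size of the complex stretching coefficients. -/

/-- The polynomial which equals the stretched coordinate in the PML. -/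
def stretchPoly (c R r : ℝ) : ℂ := (r : ℂ) + (1 + Complex.I) * ((c * (r - R) ^ 2 : ℝ) : ℂ)

/-- The derivative of `stretchPoly`. -/
def alphaPoly (c R r : ℝ) : ℂ := 1 + (1 + Complex.I) * ((2 * c * (r - R) : ℝ) : ℂ)

section Coefficients

variable {c R r : ℝ}

theorem stretchPoly_re : (stretchPoly c R r).re = r + c * (r - R) ^ 2 := by
  simp [stretchPoly, -Complex.ofReal_mul]

theorem stretchPoly_im : (stretchPoly c R r).im = c * (r - R) ^ 2 := by
  simp [stretchPoly, -Complex.ofReal_mul]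

theorem alphaPoly_re : (alphaPoly c R r).re = 1 + 2 * c * (r - R) := by
  simp [alphaPoly]

theorem alphaPoly_im : (alphaPoly c R r).im = 2 * c * (r - R) := by
  simp [alphaPoly]

theorem contDiff_stretchPoly : ContDiff ℝ ∞ (stretchPoly c R) := by
  unfold stretchPoly
  refine Complex.ofRealCLM.contDiff.add (contDiff_const.mul (Complex.ofRealCLM.contDiff.comp
    (f := fun r : ℝ => c * (r - R) ^ 2) ?_))
  fun_prop

theorem contDiff_alphaPoly : ContDiff ℝ ∞ (alphaPoly c R) := by
  unfold alphaPoly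
  refine contDiff_const.add (contDiff_const.mul (Complex.ofRealCLM.contDiff.comp
    (f := fun r : ℝ => 2 * c * (r - R)) ?_))
  fun_prop

theorem hasDerivAt_stretchPoly : HasDerivAt (stretchPoly c R) (alphaPoly c R r) r := by
  have h1 : HasDerivAt (fun r : ℝ => c * (r - R) ^ 2) (2 * c * (r - R)) r := by
    convert! (((hasDerivAt_id r).sub_const R).pow 2).const_mul c using 1
    simp; ring
  exact (Complex.ofRealCLM.hasDerivAt (x := r)).add (h1.ofReal_comp.const_mul (1 + Complex.I))

/-- There is no restriction to r ≥ R, so α/F is smooth on the whole line. The global existence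
theorem and Green's formulas against functions smooth on the whole plane both need this. -/
theorem stretchPoly_ne_zero (hc : 0 < c) (hR : 0 < R) : stretchPoly c R r ≠ 0 := by
  intro h
  have h1 := congrArg Complex.im h
  have h2 := congrArg Complex.re h
  rw [stretchPoly_im, Complex.zero_im] at h1
  rw [stretchPoly_re, h1, Complex.zero_re] at h2
  have h3 : r = 0 := by linarith
  rw [h3] at h1
  have : 0 < c * (0 - R) ^ 2 := by nlinarith [mul_pos hc (mul_pos hR hR)]
  linarith

theorem alphaPoly_ne_zero : alphaPoly c R r ≠ 0 := by
  intro h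
  have h1 := congrArg Complex.im h
  have h2 := congrArg Complex.re h
  rw [alphaPoly_im, Complex.zero_im] at h1
  rw [alphaPoly_re, h1, Complex.zero_re] at h2
  linarith

/-- The lower bound vanishes linearly at the interface; this degeneracy is what makes the
propagating modes delicate. -/
theorem mul_im_ge (hc : 0 < c) (hR : 0 < R) (hr : R ≤ r) :
    2 * c * (r - R) * R ≤ (alphaPoly c R r * stretchPoly c R r).im := by
  rw [Complex.mul_im, alphaPoly_re, alphaPoly_im, stretchPoly_re, stretchPoly_im]
  have hx : 0 ≤ r - R := by linarith
  have h1 : 0 ≤ (1 + 2 * c * (r - R)) * (c * (r - R) ^ 2) := by positivity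
  have h2 : 2 * c * (r - R) * R ≤ 2 * c * (r - R) * (r + c * (r - R) ^ 2) := by
    have : R ≤ r + c * (r - R) ^ 2 := by have : 0 ≤ c * (r - R) ^ 2 := by positivity
                                         linarith
    gcongr
  linarith

/-- The terms 2c²(r - R)³ in Re α Re F and Im α Im F cancel, because the real and imaginary parts of
the stretching profile are equal; only nonnegative terms remain besides r. -/
theorem mul_re_ge (hc : 0 < c) (hR : 0 < R) (hr : R ≤ r) :
    R ≤ (alphaPoly c R r * stretchPoly c R r).re := by
  rw [Complex.mul_re, alphaPoly_re, alphaPoly_im, stretchPoly_re, stretchPoly_im]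
  have hx : 0 ≤ r - R := by linarith
  have h1 : 0 ≤ c * (r - R) ^ 2 := by positivity
  have h2 : 0 ≤ 2 * c * (r - R) * r := mul_nonneg (by positivity) (by linarith)
  nlinarith

/-- In Im(α F̄) the cubic terms cancel again, leaving c(r - R)(2r - (r - R)). -/
theorem div_im_eq : (alphaPoly c R r / stretchPoly c R r).im
    = c * (r - R) * (r + R) / ‖stretchPoly c R r‖ ^ 2 := by
  rw [Complex.div_im, alphaPoly_re, alphaPoly_im, Complex.normSq_eq_norm_sq, stretchPoly_re,
    stretchPoly_im]
  ring

theorem div_re_ge (hc : 0 < c) (hR : 0 < R) (hr : R ≤ r) :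
    (alphaPoly c R r).re * R / ‖stretchPoly c R r‖ ^ 2
      ≤ (alphaPoly c R r / stretchPoly c R r).re := by
  have hx : 0 ≤ r - R := by linarith
  rw [Complex.div_re, Complex.normSq_eq_norm_sq, ← add_div]
  gcongr
  rw [alphaPoly_re, alphaPoly_im, stretchPoly_re, stretchPoly_im]
  have h1 : (1 + 2 * c * (r - R)) * R ≤ (1 + 2 * c * (r - R)) * (r + c * (r - R) ^ 2) := by
    have : R ≤ r + c * (r - R) ^ 2 := by have : 0 ≤ c * (r - R) ^ 2 := by positivity
                                         linarith
    gcongr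
  have h2 : 0 ≤ 2 * c * (r - R) * (c * (r - R) ^ 2) := by positivity
  linarith

theorem alphaPoly_re_ge (hc : 0 < c) (hr : R ≤ r) : 1 ≤ (alphaPoly c R r).re := by
  rw [alphaPoly_re]
  have : 0 ≤ 2 * c * (r - R) := mul_nonneg (by positivity) (by linarith)
  linarith

theorem one_le_norm_alphaPoly (hc : 0 < c) (hr : R ≤ r) : 1 ≤ ‖alphaPoly c R r‖ :=
  (alphaPoly_re_ge hc hr).trans (Complex.re_le_norm _)

theorem norm_alphaPoly_sq_le (hc : 0 < c) (hr : R ≤ r) :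
    ‖alphaPoly c R r‖ ^ 2 ≤ 2 * (alphaPoly c R r).re ^ 2 := by
  rw [← Complex.normSq_eq_norm_sq, Complex.normSq_apply, alphaPoly_re, alphaPoly_im]
  have : 0 ≤ 2 * c * (r - R) := mul_nonneg (by positivity) (by linarith)
  nlinarith

theorem norm_alphaPoly_mono {s : ℝ} (hc : 0 < c) (hr : R ≤ r) (hrs : r ≤ s) :
    ‖alphaPoly c R r‖ ≤ ‖alphaPoly c R s‖ := by
  refine le_of_sq_le_sq ?_ (norm_nonneg _)
  rw [← Complex.normSq_eq_norm_sq, ← Complex.normSq_eq_norm_sq, Complex.normSq_apply,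
    Complex.normSq_apply, alphaPoly_re, alphaPoly_im, alphaPoly_re, alphaPoly_im]
  have h1 : 0 ≤ 2 * c * (r - R) := mul_nonneg (by positivity) (by linarith)
  have h2 : 2 * c * (r - R) ≤ 2 * c * (s - R) := by gcongr
  nlinarith

theorem le_norm_stretchPoly (hc : 0 < c) (hr : R ≤ r) : R ≤ ‖stretchPoly c R r‖ := by
  refine le_trans ?_ (Complex.re_le_norm _)
  rw [stretchPoly_re]
  have : 0 ≤ c * (r - R) ^ 2 := by positivity
  linarith

/-- Both 1 and 2cR are at most |α(2R)|, so 2R + 2cR² ≤ 3R |α(2R)|. -/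
theorem norm_stretchPoly_le (hc : 0 < c) (hR : 0 < R) (hr : R ≤ r) (hr2 : r ≤ 2 * R) :
    ‖stretchPoly c R r‖ ≤ 3 * R * ‖alphaPoly c R (2 * R)‖ := by
  have h1 : ‖stretchPoly c R r‖ ≤ r + 2 * (c * (r - R) ^ 2) := by
    refine (Complex.norm_le_abs_re_add_abs_im _).trans ?_
    have h : 0 ≤ c * (r - R) ^ 2 := by positivity
    rw [stretchPoly_re, stretchPoly_im, abs_of_nonneg (by linarith), abs_of_nonneg h]
    linarith
  have h2 : c * (r - R) ^ 2 ≤ c * R ^ 2 := by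
    gcongr
    linarith
  have h3 : 1 ≤ ‖alphaPoly c R (2 * R)‖ := one_le_norm_alphaPoly hc (by linarith)
  have h4 : 2 * c * R ≤ ‖alphaPoly c R (2 * R)‖ := by
    refine le_trans (le_of_eq ?_) (Complex.im_le_norm _)
    rw [alphaPoly_im]; ring
  nlinarith

theorem norm_alphaPoly_le (hc : 0 < c) (hr : R ≤ r) :
    ‖alphaPoly c R r‖ ≤ 1 + 4 * c * (r - R) := by
  have h : 0 ≤ 2 * c * (r - R) := mul_nonneg (by positivity) (by linarith)
  refine (Complex.norm_le_abs_re_add_abs_im _).trans ?_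
  rw [alphaPoly_re, alphaPoly_im, abs_of_nonneg (by linarith), abs_of_nonneg h]
  linarith

end Coefficients

/-! ### The radial system of one mode and its energy identities. -/

/-- Solutions of the radial equation of a mode, as a first order system in `w` and
`p = w' / (α F)`. -/
structure ModeSystem (c R q : ℝ) (w p : ℝ → ℂ) : Prop where
  contDiff_w : ContDiff ℝ ∞ w
  contDiff_p : ContDiff ℝ ∞ p
  deriv_w : ∀ r, HasDerivAt w (alphaPoly c R r * stretchPoly c R r * p r) r
  deriv_p : ∀ r, HasDerivAt p (-(q : ℂ) * (alphaPoly c R r / stretchPoly c R r) * w r) r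

theorem contDiff_ratio {c R : ℝ} (hc : 0 < c) (hR : 0 < R) :
    ContDiff ℝ ∞ fun r => alphaPoly c R r / stretchPoly c R r := by
  simp only [div_eq_mul_inv]
  exact contDiff_alphaPoly.mul (contDiff_stretchPoly.inv fun _ => stretchPoly_ne_zero hc hR)

theorem contDiff_product {c R : ℝ} :
    ContDiff ℝ ∞ fun r => alphaPoly c R r * stretchPoly c R r :=
  contDiff_alphaPoly.mul contDiff_stretchPoly

namespace ModeSystem

variable {c R q : ℝ} {w p : ℝ → ℂ}

theorem exists_solution (hc : 0 < c) (hR : 0 < R) (ρ : ℝ) :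
    ∃ w p : ℝ → ℂ, w ρ = 0 ∧ p ρ = 1 ∧ ModeSystem c R q w p := by
  obtain ⟨w, p, hw0, hp0, hw, hp, hw', hp'⟩ := exists_smooth_system
    (fun r => alphaPoly c R r * stretchPoly c R r)
    (fun r => -(q : ℂ) * (alphaPoly c R r / stretchPoly c R r)) contDiff_product
    (contDiff_const.mul (contDiff_ratio hc hR)) ρ 0 1
  exact ⟨w, p, hw0, hp0, hw, hp, hw', hp'⟩

theorem const_mul (h : ModeSystem c R q w p) (b : ℂ) :
    ModeSystem c R q (fun r => b * w r) (fun r => b * p r) where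
  contDiff_w := contDiff_const.mul h.contDiff_w
  contDiff_p := contDiff_const.mul h.contDiff_p
  deriv_w r := by convert! (h.deriv_w r).const_mul b using 1; ring
  deriv_p r := by convert! (h.deriv_p r).const_mul b using 1; ring

/-- The real part of this derivative is `reDensity` and its imaginary part is minus `imDensity`. The
former is nonnegative on r ≥ R for q ≤ 0, the latter density for q ≥ 0, so every real q has a
definite energy. -/
theorem hasDerivAt_flux (h : ModeSystem c R q w p) (r : ℝ) :
    HasDerivAt (fun r => p r * star (w r))
      (star (alphaPoly c R r * stretchPoly c R r) * (‖p r‖ ^ 2 : ℝ)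
        - q * (alphaPoly c R r / stretchPoly c R r) * (‖w r‖ ^ 2 : ℝ)) r := by
  convert! (h.deriv_p r).mul (h.deriv_w r).star using 1
  have h1 : (((‖p r‖ ^ 2 : ℝ)) : ℂ) = p r * star (p r) := by
    rw [Complex.star_def, Complex.mul_conj']; push_cast; rfl
  have h2 : (((‖w r‖ ^ 2 : ℝ)) : ℂ) = w r * star (w r) := by
    rw [Complex.star_def, Complex.mul_conj']; push_cast; rfl
  rw [h1, h2]
  simp only [star_mul']
  ring

theorem continuous_w (h : ModeSystem c R q w p) : Continuous w := h.contDiff_w.continuous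

theorem continuous_p (h : ModeSystem c R q w p) : Continuous p := h.contDiff_p.continuous

/-- The imaginary part of the energy density. -/
def imDensity (c R q : ℝ) (w p : ℝ → ℂ) (r : ℝ) : ℝ :=
  q * (alphaPoly c R r / stretchPoly c R r).im * ‖w r‖ ^ 2
    + (alphaPoly c R r * stretchPoly c R r).im * ‖p r‖ ^ 2

/-- The real part of the energy density. -/
def reDensity (c R q : ℝ) (w p : ℝ → ℂ) (r : ℝ) : ℝ :=
  -q * (alphaPoly c R r / stretchPoly c R r).re * ‖w r‖ ^ 2
    + (alphaPoly c R r * stretchPoly c R r).re * ‖p r‖ ^ 2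

theorem continuous_imDensity (hc : 0 < c) (hR : 0 < R) (h : ModeSystem c R q w p) :
    Continuous (imDensity c R q w p) := by
  have h1 := (contDiff_ratio hc hR).continuous
  have h2 := (contDiff_product (c := c) (R := R)).continuous
  have h3 := h.continuous_w
  have h4 := h.continuous_p
  exact ((continuous_const.mul (Complex.continuous_im.comp h1)).mul (h3.norm.pow 2)).add
    ((Complex.continuous_im.comp h2).mul (h4.norm.pow 2))

theorem continuous_reDensity (hc : 0 < c) (hR : 0 < R) (h : ModeSystem c R q w p) :
    Continuous (reDensity c R q w p) := by
  have h1 := (contDiff_ratio hc hR).continuous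
  have h2 := (contDiff_product (c := c) (R := R)).continuous
  have h3 := h.continuous_w
  have h4 := h.continuous_p
  exact ((continuous_const.mul (Complex.continuous_re.comp h1)).mul (h3.norm.pow 2)).add
    ((Complex.continuous_re.comp h2).mul (h4.norm.pow 2))

theorem im_flux_eq (hc : 0 < c) (hR : 0 < R) (h : ModeSystem c R q w p) {ρ : ℝ} (hρ : w ρ = 0) :
    ∫ r in R..ρ, imDensity c R q w p r = (p R * star (w R)).im := by
  have hd : ∀ r, HasDerivAt (fun r => -(p r * star (w r)).im) (imDensity c R q w p r) r := by
    intro r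
    convert! (Complex.imCLM.hasFDerivAt.comp_hasDerivAt r (h.hasDerivAt_flux r)).neg using 1
    simp only [imDensity, Complex.imCLM_apply, Complex.sub_im]
    rw [Complex.im_mul_ofReal, Complex.im_mul_ofReal, Complex.im_ofReal_mul, Complex.star_def,
      Complex.conj_im]
    ring
  rw [intervalIntegral.integral_eq_sub_of_hasDerivAt (fun r _ => hd r)
    ((continuous_imDensity hc hR h).intervalIntegrable _ _), hρ]
  simp

theorem re_flux_eq (hc : 0 < c) (hR : 0 < R) (h : ModeSystem c R q w p) {ρ : ℝ} (hρ : w ρ = 0) :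
    ∫ r in R..ρ, reDensity c R q w p r = -(p R * star (w R)).re := by
  have hd : ∀ r, HasDerivAt (fun r => (p r * star (w r)).re) (reDensity c R q w p r) r := by
    intro r
    convert! (Complex.reCLM.hasFDerivAt.comp_hasDerivAt r (h.hasDerivAt_flux r)) using 1
    simp only [reDensity, Complex.reCLM_apply, Complex.sub_re]
    rw [Complex.re_mul_ofReal, Complex.re_mul_ofReal, Complex.re_ofReal_mul, Complex.star_def,
      Complex.conj_re]
    ring
  rw [intervalIntegral.integral_eq_sub_of_hasDerivAt (fun r _ => hd r)
    ((continuous_reDensity hc hR h).intervalIntegrable _ _), hρ]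
  simp

theorem div_im_nonneg {r : ℝ} (hc : 0 < c) (hR : 0 < R) (hr : R ≤ r) :
    0 ≤ (alphaPoly c R r / stretchPoly c R r).im := by
  rw [div_im_eq]
  have : 0 ≤ r - R := by linarith
  have : 0 ≤ r + R := by linarith
  positivity

theorem div_re_nonneg {r : ℝ} (hc : 0 < c) (hR : 0 < R) (hr : R ≤ r) :
    0 ≤ (alphaPoly c R r / stretchPoly c R r).re := by
  refine le_trans ?_ (div_re_ge hc hR hr)
  have := alphaPoly_re_ge hc hr
  positivity

theorem mul_im_nonneg {r : ℝ} (hc : 0 < c) (hR : 0 < R) (hr : R ≤ r) :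
    0 ≤ (alphaPoly c R r * stretchPoly c R r).im := by
  refine le_trans ?_ (mul_im_ge hc hR hr)
  have : 0 ≤ r - R := by linarith
  positivity

theorem imDensity_nonneg {r : ℝ} (hc : 0 < c) (hR : 0 < R) (hq : 0 ≤ q) (hr : R ≤ r) :
    0 ≤ imDensity c R q w p r := by
  have h1 := div_im_nonneg hc hR hr
  have h2 := mul_im_nonneg hc hR hr
  unfold imDensity
  positivity

theorem reDensity_nonneg {r : ℝ} (hc : 0 < c) (hR : 0 < R) (hq : q ≤ 0) (hr : R ≤ r) :
    0 ≤ reDensity c R q w p r := by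
  have h1 := div_re_nonneg hc hR hr
  have h2 := hR.le.trans (mul_re_ge hc hR hr)
  have h3 : 0 ≤ -q := by linarith
  unfold reDensity
  positivity

/-- A nontrivial solution which vanishes at `ρ` does not vanish at `R`. -/
theorem ne_zero_of_end (hc : 0 < c) (hR : 0 < R) (h : ModeSystem c R q w p) {ρ : ℝ} (hRρ : R < ρ)
    (hρ : w ρ = 0) (hp : p ρ ≠ 0) : w R ≠ 0 := by
  intro h0
  have hpp : 0 < ‖p ρ‖ ^ 2 := by have := norm_pos_iff.2 hp; positivity
  -- If w also vanished at R, the flux would be zero at both ends and the definite density would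
  -- integrate to zero. Yet it is positive at ρ, where p ≠ 0.
  rcases le_or_gt q 0 with hq | hq
  · have := intervalIntegral.integral_pos hRρ (continuous_reDensity hc hR h).continuousOn
      (fun r hr => reDensity_nonneg hc hR hq hr.1.le)
      ⟨ρ, right_mem_Icc.2 hRρ.le, by
        unfold reDensity
        rw [hρ]
        have := mul_re_ge hc hR hRρ.le
        simp only [norm_zero]
        have : 0 < (alphaPoly c R ρ * stretchPoly c R ρ).re := by linarith
        have := mul_pos this hpp
        simpa using this⟩
    rw [re_flux_eq hc hR h hρ, h0] at this
    simp at this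
  · have := intervalIntegral.integral_pos hRρ (continuous_imDensity hc hR h).continuousOn
      (fun r hr => imDensity_nonneg hc hR hq.le hr.1.le)
      ⟨ρ, right_mem_Icc.2 hRρ.le, by
        unfold imDensity
        rw [hρ]
        have h1 := mul_im_ge hc hR hRρ.le
        have h2 : 0 < 2 * c * (ρ - R) * R := by
          have : 0 < ρ - R := by linarith
          positivity
        have : 0 < (alphaPoly c R ρ * stretchPoly c R ρ).im := by linarith
        have := mul_pos this hpp
        simpa using this⟩
    rw [im_flux_eq hc hR h hρ, h0] at this
    simp at this

/-- Solvability of the radial Dirichlet problem. -/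
theorem exists_dirichlet (q : ℝ) (hc : 0 < c) (hR : 0 < R) {ρ : ℝ} (hRρ : R < ρ) :
    ∃ w p : ℝ → ℂ, ModeSystem c R q w p ∧ w R = 1 ∧ w ρ = 0 := by
  -- Shooting from ρ with w = 0, p = 1, then normalising at R.
  obtain ⟨w, p, hw, hp, h⟩ := exists_solution (q := q) hc hR ρ
  have h0 := ne_zero_of_end hc hR h hRρ hw (by rw [hp]; exact one_ne_zero)
  exact ⟨_, _, h.const_mul (w R)⁻¹, inv_mul_cancel₀ h0, by simp [hw]⟩

end ModeSystem

/-! ### Bounds of the Neumann datum from a layer next to the interface. -/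

namespace ModeSystem

variable {c R q : ℝ} {w p : ℝ → ℂ}

/-- A quadratic cutoff which equals `1` at `R` and `0` at `R + δ`. -/
def cutoff (R δ r : ℝ) : ℝ := 1 - ((r - R) / δ) ^ 2

theorem continuous_cutoff {R δ : ℝ} : Continuous (cutoff R δ) := by
  unfold cutoff; fun_prop

theorem hasDerivAt_cutoff {R δ r : ℝ} : HasDerivAt (cutoff R δ) (-(2 * (r - R) / δ ^ 2)) r := by
  convert! ((((hasDerivAt_id r).sub_const R).div_const δ).pow 2).const_sub 1 using 1
  simp; ring

theorem cutoff_mem {R δ r : ℝ} (hδ : 0 < δ) (hr : r ∈ Icc R (R + δ)) :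
    0 ≤ cutoff R δ r ∧ cutoff R δ r ≤ 1 := by
  have h0 : 0 ≤ (r - R) / δ := div_nonneg (by linarith [hr.1]) hδ.le
  have h1 : (r - R) / δ ≤ 1 := by rw [div_le_one hδ]; linarith [hr.2]
  unfold cutoff
  constructor <;> nlinarith

theorem cutoff_left {R δ : ℝ} : cutoff R δ R = 1 := by simp [cutoff]

theorem cutoff_right {R δ : ℝ} (hδ : 0 < δ) : cutoff R δ (R + δ) = 0 := by
  simp [cutoff, hδ.ne']

/-- Integrating -(p g)' over the layer, with g the cutoff, recovers p(R). The cutoff is quadratic so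
that its derivative carries a factor r - R, which matches the degenerate weight of the imaginary
energy. -/
theorem norm_p_le (hc : 0 < c) (hR : 0 < R) (h : ModeSystem c R q w p) {δ : ℝ} (hδ : 0 < δ) :
    ‖p R‖ ≤ ∫ r in R..(R + δ), (|q| * ‖alphaPoly c R r / stretchPoly c R r‖ * ‖w r‖ * cutoff R δ r
      + 2 * (r - R) / δ ^ 2 * ‖p r‖) := by
  have hQ := (contDiff_ratio hc hR).continuous
  have hw := h.continuous_w
  have hp := h.continuous_p
  have hg := continuous_cutoff (R := R) (δ := δ)
  have hd : ∀ r, HasDerivAt (fun r => -(p r * (cutoff R δ r : ℂ)))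
      (q * (alphaPoly c R r / stretchPoly c R r) * w r * (cutoff R δ r : ℂ)
        + ((2 * (r - R) / δ ^ 2 : ℝ) : ℂ) * p r) r := by
    intro r
    convert! ((h.deriv_p r).mul (hasDerivAt_cutoff (R := R) (δ := δ) (r := r)).ofReal_comp).neg
      using 1
    push_cast; ring
  have e : p R = ∫ r in R..(R + δ), (q * (alphaPoly c R r / stretchPoly c R r) * w r
      * (cutoff R δ r : ℂ) + ((2 * (r - R) / δ ^ 2 : ℝ) : ℂ) * p r) := by
    rw [intervalIntegral.integral_eq_sub_of_hasDerivAt (fun r _ => hd r)]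
    · rw [cutoff_left, cutoff_right hδ]; simp
    · apply Continuous.intervalIntegrable
      exact (((continuous_const.mul hQ).mul hw).mul (Complex.continuous_ofReal.comp hg)).add
        ((Complex.continuous_ofReal.comp (by fun_prop)).mul hp)
  rw [e]
  refine intervalIntegral.norm_integral_le_of_norm_le (by linarith)
    (Filter.Eventually.of_forall fun r hr => ?_) ?_
  · have hr' : r ∈ Icc R (R + δ) := ⟨hr.1.le, hr.2⟩
    refine (norm_add_le _ _).trans (le_of_eq ?_)
    have h2 : 0 ≤ 2 * (r - R) / δ ^ 2 := by
      have : 0 ≤ r - R := by linarith [hr.1]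
      positivity
    rw [norm_mul, norm_mul, norm_mul, norm_mul, Complex.norm_real, Complex.norm_real,
      Complex.norm_real, Real.norm_eq_abs, Real.norm_of_nonneg (cutoff_mem hδ hr').1,
      Real.norm_of_nonneg h2]
  · apply Continuous.intervalIntegrable
    exact (((continuous_const.mul hQ.norm).mul hw.norm).mul hg).add
        ((by fun_prop : Continuous fun r : ℝ => 2 * (r - R) / δ ^ 2).mul hp.norm)

/-- A weighted Hardy type inequality for the component `w`. -/
theorem hardy (h : ModeSystem c R q w p) {δ s : ℝ} (hδ : 0 < δ) (hs : 0 < s) :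
    ∫ r in R..(R + δ), cutoff R δ r * ‖w r‖ ^ 2
      ≤ ∫ r in R..(R + δ), ((2 / δ + s) * ((r - R) * ‖w r‖ ^ 2)
        + ‖alphaPoly c R r * stretchPoly c R r‖ ^ 2 / s * ((r - R) * ‖p r‖ ^ 2)) := by
  have hS := (contDiff_product (c := c) (R := R)).continuous
  have hw := h.continuous_w
  have hp := h.continuous_p
  have hg := continuous_cutoff (R := R) (δ := δ)
  have hi : Continuous fun r => (inner ℝ (w r) (alphaPoly c R r * stretchPoly c R r * p r) : ℝ) :=
    hw.inner (hS.mul hp)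
  -- The factor r - R kills the boundary term at R and the cutoff kills the one at R + δ. The term 2
  -- Re(w̄ w') is split by Young's inequality with parameter s, and (r - R)²/δ² ≤ (r - R)/δ on the
  -- layer.
  have hd : ∀ r, HasDerivAt (fun r => (r - R) * cutoff R δ r * ‖w r‖ ^ 2)
      (cutoff R δ r * ‖w r‖ ^ 2 - (2 * (r - R) ^ 2 / δ ^ 2 * ‖w r‖ ^ 2
        - 2 * (r - R) * cutoff R δ r
          * inner ℝ (w r) (alphaPoly c R r * stretchPoly c R r * p r))) r := by
    intro r
    convert! (((hasDerivAt_id r).sub_const R).mul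
      (hasDerivAt_cutoff (R := R) (δ := δ) (r := r))).mul (h.deriv_w r).norm_sq using 1
    simp; ring
  have hc1 : Continuous fun r => cutoff R δ r * ‖w r‖ ^ 2 := hg.mul (hw.norm.pow 2)
  have hc2 : Continuous fun r => 2 * (r - R) ^ 2 / δ ^ 2 * ‖w r‖ ^ 2
        - 2 * (r - R) * cutoff R δ r
          * inner ℝ (w r) (alphaPoly c R r * stretchPoly c R r * p r) :=
    ((by fun_prop : Continuous fun r : ℝ => 2 * (r - R) ^ 2 / δ ^ 2).mul (hw.norm.pow 2)).sub
      (((by fun_prop : Continuous fun r : ℝ => 2 * (r - R)).mul hg).mul hi)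
  have e : (∫ r in R..(R + δ), cutoff R δ r * ‖w r‖ ^ 2)
      = ∫ r in R..(R + δ), (2 * (r - R) ^ 2 / δ ^ 2 * ‖w r‖ ^ 2
        - 2 * (r - R) * cutoff R δ r
          * inner ℝ (w r) (alphaPoly c R r * stretchPoly c R r * p r)) := by
    have h1 := intervalIntegral.integral_eq_sub_of_hasDerivAt (a := R) (b := R + δ)
      (fun r _ => hd r) ((hc1.sub hc2).intervalIntegrable _ _)
    rw [intervalIntegral.integral_sub (hc1.intervalIntegrable _ _) (hc2.intervalIntegrable _ _),
      cutoff_right hδ] at h1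
    simp only [mul_zero, zero_mul, sub_self] at h1
    linarith
  rw [e]
  refine intervalIntegral.integral_mono_on (by linarith) (hc2.intervalIntegrable _ _) ?_
    fun r hr => ?_
  · apply Continuous.intervalIntegrable
    exact (continuous_const.mul ((by fun_prop : Continuous fun r : ℝ => r - R).mul
      (hw.norm.pow 2))).add (((hS.norm.pow 2).div_const s).mul
        ((by fun_prop : Continuous fun r : ℝ => r - R).mul (hp.norm.pow 2)))
  · obtain ⟨hg0, hg1⟩ := cutoff_mem hδ hr
    have hx : 0 ≤ r - R := by linarith [hr.1]
    set S := ‖alphaPoly c R r * stretchPoly c R r‖ with hSdef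
    have h1 : 2 * (r - R) ^ 2 / δ ^ 2 * ‖w r‖ ^ 2 ≤ 2 / δ * ((r - R) * ‖w r‖ ^ 2) := by
      have : 2 * (r - R) ^ 2 / δ ^ 2 ≤ 2 / δ * (r - R) := by
        rw [div_le_iff₀ (by positivity)]
        have : 2 / δ * (r - R) * δ ^ 2 = 2 * (r - R) * δ := by field_simp
        rw [this]
        nlinarith [hr.2]
      nlinarith [mul_le_mul_of_nonneg_right this (sq_nonneg ‖w r‖)]
    have h2 : |inner ℝ (w r) (alphaPoly c R r * stretchPoly c R r * p r)|
        ≤ ‖w r‖ * (S * ‖p r‖) := by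
      refine (abs_real_inner_le_norm _ _).trans ?_
      rw [norm_mul]
    have h3 : 2 * (‖w r‖ * (S * ‖p r‖)) ≤ s * ‖w r‖ ^ 2 + S ^ 2 / s * ‖p r‖ ^ 2 := by
      have h := sq_nonneg (s * ‖w r‖ - S * ‖p r‖)
      have h' : s * ‖w r‖ ^ 2 + S ^ 2 / s * ‖p r‖ ^ 2
          = (s ^ 2 * ‖w r‖ ^ 2 + S ^ 2 * ‖p r‖ ^ 2) / s := by field_simp
      rw [h', le_div_iff₀ hs]
      nlinarith
    have h4 : -(2 * (r - R) * cutoff R δ r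
          * inner ℝ (w r) (alphaPoly c R r * stretchPoly c R r * p r))
        ≤ (r - R) * (s * ‖w r‖ ^ 2 + S ^ 2 / s * ‖p r‖ ^ 2) := by
      have h5 : -(cutoff R δ r * inner ℝ (w r) (alphaPoly c R r * stretchPoly c R r * p r))
          ≤ ‖w r‖ * (S * ‖p r‖) := by
        refine (neg_le_abs _).trans ?_
        rw [abs_mul, abs_of_nonneg hg0]
        exact (mul_le_of_le_one_left (abs_nonneg _) hg1).trans h2
      have h6 := mul_le_mul_of_nonneg_left (by linarith : 2 * -(cutoff R δ r
        * inner ℝ (w r) (alphaPoly c R r * stretchPoly c R r * p r))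
          ≤ s * ‖w r‖ ^ 2 + S ^ 2 / s * ‖p r‖ ^ 2) hx
      linarith
    linarith

/-- Since w(R) = 1, the flux at R is p(R) itself. The energy is thus bounded linearly in |p(R)|,
which makes absorption by Young's inequality possible. -/
theorem integral_reDensity_le (hc : 0 < c) (hR : 0 < R) (h : ModeSystem c R q w p) (hq : q ≤ 0)
    {ρ s : ℝ} (hs : R ≤ s) (hsρ : s ≤ ρ) (hw : w R = 1) (hρ : w ρ = 0) :
    ∫ r in R..s, reDensity c R q w p r ≤ ‖p R‖ := by
  have h1 : ∫ r in R..s, reDensity c R q w p r ≤ ∫ r in R..ρ, reDensity c R q w p r := by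
    refine intervalIntegral.integral_mono_interval le_rfl hs hsρ ?_
      ((continuous_reDensity hc hR h).intervalIntegrable _ _)
    filter_upwards [ae_restrict_mem measurableSet_Ioc] with r hr
    exact reDensity_nonneg hc hR hq hr.1.le
  rw [re_flux_eq hc hR h hρ, hw] at h1
  refine h1.trans ?_
  simp only [star_one, mul_one]
  exact (neg_le_abs _).trans (Complex.abs_re_le_norm _)

theorem integral_imDensity_le (hc : 0 < c) (hR : 0 < R) (h : ModeSystem c R q w p) (hq : 0 ≤ q)
    {ρ s : ℝ} (hs : R ≤ s) (hsρ : s ≤ ρ) (hw : w R = 1) (hρ : w ρ = 0) :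
    ∫ r in R..s, imDensity c R q w p r ≤ ‖p R‖ := by
  have h1 : ∫ r in R..s, imDensity c R q w p r ≤ ∫ r in R..ρ, imDensity c R q w p r := by
    refine intervalIntegral.integral_mono_interval le_rfl hs hsρ ?_
      ((continuous_imDensity hc hR h).intervalIntegrable _ _)
    filter_upwards [ae_restrict_mem measurableSet_Ioc] with r hr
    exact imDensity_nonneg hc hR hq hr.1.le
  rw [im_flux_eq hc hR h hρ, hw] at h1
  refine h1.trans ?_
  simp only [star_one, mul_one]
  exact Complex.im_le_norm _

/-- The Neumann datum of an evanescent mode. -/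
theorem evanescent_bound (hc : 0 < c) (hR : 0 < R) (h : ModeSystem c R q w p) (hq : q ≤ 0)
    {ρ m B : ℝ} (hρR : 2 * R ≤ ρ) (hw : w R = 1) (hρ : w ρ = 0) (hm : 1 ≤ m)
    (hB : -q ≤ B * m ^ 2) :
    ‖p R‖ ≤ (4 * B + 8 / R ^ 2) * m * ‖alphaPoly c R (2 * R)‖ := by
  set a := ‖alphaPoly c R (2 * R)‖ with ha
  have ha1 : 1 ≤ a := one_le_norm_alphaPoly hc (by linarith)
  have hm0 : 0 < m := by linarith
  -- With -q ≤ B m², the two contributions to δK are of order δm² and 1/δ; the thickness R/m makes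
  -- both of order m.
  set δ := R / m with hδdef
  have hδ : 0 < δ := by positivity
  have hδR : δ ≤ R := div_le_self hR.le hm
  -- The constants left over by Young's inequality in the w-term and the p-term, each arranged to
  -- cost a quarter of the corresponding energy.
  set K := 2 * a * (-q) / R + 4 / (δ ^ 2 * R) with hK
  have hGc := continuous_reDensity hc hR h
  have h1 := norm_p_le hc hR h hδ
  have hQ := (contDiff_ratio hc hR).continuous
  have hwc := h.continuous_w
  have hpc := h.continuous_p
  have hg := continuous_cutoff (R := R) (δ := δ)
  have h2 : ∫ r in R..(R + δ), (|q| * ‖alphaPoly c R r / stretchPoly c R r‖ * ‖w r‖ * cutoff R δ r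
      + 2 * (r - R) / δ ^ 2 * ‖p r‖) ≤ ∫ r in R..(R + δ), (K + reDensity c R q w p r / 4) := by
    refine intervalIntegral.integral_mono_on (by linarith) ?_ ?_ fun r hr => ?_
    · apply Continuous.intervalIntegrable
      exact (((continuous_const.mul hQ.norm).mul hwc.norm).mul hg).add
        ((by fun_prop : Continuous fun r : ℝ => 2 * (r - R) / δ ^ 2).mul hpc.norm)
    · exact (continuous_const.add (hGc.div_const 4)).intervalIntegrable _ _
    · obtain ⟨hg0, hg1⟩ := cutoff_mem hδ hr
      have hx : 0 ≤ r - R := by linarith [hr.1]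
      have hx' : r - R ≤ δ := by linarith [hr.2]
      have hSre := mul_re_ge hc hR hr.1
      have hQre := div_re_ge hc hR hr.1
      have hA1 := alphaPoly_re_ge hc hr.1
      have hA2 := norm_alphaPoly_sq_le hc hr.1
      have hAa : (alphaPoly c R r).re ≤ a :=
        (Complex.re_le_norm _).trans (norm_alphaPoly_mono hc hr.1 (by linarith [hr.2]))
      have hF : 0 < ‖stretchPoly c R r‖ := norm_pos_iff.2 (stretchPoly_ne_zero hc hR)
      set Q := ‖alphaPoly c R r / stretchPoly c R r‖ with hQd
      set Qr := (alphaPoly c R r / stretchPoly c R r).re with hQr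
      set Sr := (alphaPoly c R r * stretchPoly c R r).re with hSr
      have hQr0 : 0 ≤ Qr := div_re_nonneg hc hR hr.1
      -- The modulus of α/F is controlled by its real part: |Im α| ≤ Re α and Re(α/F) ≥ R Re α /
      -- |F|². One factor Re α ≤ a is lost.
      have hQ2 : Q ^ 2 ≤ 2 * a / R * Qr := by
        have e1 : Q ^ 2 ≤ 2 * (alphaPoly c R r).re ^ 2 / ‖stretchPoly c R r‖ ^ 2 := by
          rw [hQd, norm_div, div_pow]; gcongr
        have e2 : 2 * (alphaPoly c R r).re ^ 2 / ‖stretchPoly c R r‖ ^ 2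
            = 2 * (alphaPoly c R r).re / R
              * ((alphaPoly c R r).re * R / ‖stretchPoly c R r‖ ^ 2) := by field_simp
        rw [e2] at e1
        refine e1.trans ?_
        gcongr
      have i1 : |q| * Q * ‖w r‖ * cutoff R δ r ≤ 2 * a * (-q) / R + (-q) * Qr * ‖w r‖ ^ 2 / 4 := by
        have j0 : |q| = -q := abs_of_nonpos hq
        have j1 : Q * ‖w r‖ ≤ 2 * a / R + R / (8 * a) * (Q ^ 2 * ‖w r‖ ^ 2) := by
          have h := sq_nonneg (4 * a - R * (Q * ‖w r‖))
          have e : 2 * a / R + R / (8 * a) * (Q ^ 2 * ‖w r‖ ^ 2)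
            = (16 * a ^ 2 + R ^ 2 * (Q * ‖w r‖) ^ 2) / (8 * a * R) := by field_simp; ring
          rw [e, le_div_iff₀ (by positivity)]
          nlinarith
        have j2 : R / (8 * a) * (Q ^ 2 * ‖w r‖ ^ 2) ≤ Qr * ‖w r‖ ^ 2 / 4 := by
          have : R / (8 * a) * (Q ^ 2 * ‖w r‖ ^ 2)
              ≤ R / (8 * a) * (2 * a / R * Qr * ‖w r‖ ^ 2) := by gcongr
          refine this.trans (le_of_eq ?_)
          field_simp; ring
        have j3 : Q * ‖w r‖ * cutoff R δ r ≤ Q * ‖w r‖ :=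
          mul_le_of_le_one_right (by positivity) hg1
        have j4 := mul_le_mul_of_nonneg_left (j3.trans (j1.trans (add_le_add_right j2 _)))
          (by linarith : 0 ≤ -q)
        rw [j0]
        calc -q * Q * ‖w r‖ * cutoff R δ r = -q * (Q * ‖w r‖ * cutoff R δ r) := by ring
          _ ≤ _ := j4
          _ = _ := by ring
      have i2 : 2 * (r - R) / δ ^ 2 * ‖p r‖ ≤ 4 / (δ ^ 2 * R) + Sr * ‖p r‖ ^ 2 / 4 := by
        have j1 : 2 * (r - R) / δ ^ 2 * ‖p r‖ ≤ 2 / δ * ‖p r‖ := by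
          refine mul_le_mul_of_nonneg_right ?_ (norm_nonneg _)
          rw [div_le_div_iff₀ (by positivity) hδ]
          nlinarith
        have j2 : 2 / δ * ‖p r‖ ≤ 4 / (δ ^ 2 * R) + R * ‖p r‖ ^ 2 / 4 := by
          have h := sq_nonneg (4 - δ * R * ‖p r‖)
          have e : 4 / (δ ^ 2 * R) + R * ‖p r‖ ^ 2 / 4
            = (16 + (δ * R * ‖p r‖) ^ 2) / (4 * δ ^ 2 * R) := by field_simp; ring
          rw [e, le_div_iff₀ (by positivity)]
          have e' : 2 / δ * ‖p r‖ * (4 * δ ^ 2 * R) = 8 * (δ * R * ‖p r‖) := by field_simp; ring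
          rw [e']
          nlinarith
        have j3 : R * ‖p r‖ ^ 2 ≤ Sr * ‖p r‖ ^ 2 := by gcongr
        linarith
      have : reDensity c R q w p r = (-q) * Qr * ‖w r‖ ^ 2 + Sr * ‖p r‖ ^ 2 := rfl
      rw [this]
      linarith
  rw [intervalIntegral.integral_add (by simp) ((hGc.div_const 4).intervalIntegrable _ _),
    intervalIntegral.integral_const, intervalIntegral.integral_div, smul_eq_mul] at h2
  have h3 := integral_reDensity_le hc hR h hq (s := R + δ) (by linarith) (by linarith) hw hρ
  -- A quarter of the energy is at most ‖p R‖ / 4, which is absorbed on the left.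
  have h4 : ‖p R‖ ≤ 2 * (δ * K) := by
    have e : R + δ - R = δ := by ring
    rw [e] at h2
    linarith [norm_nonneg (p R)]
  refine h4.trans ?_
  have e : 2 * (δ * K) = 4 * a * (-q) / m + 8 / R ^ 2 * m := by
    rw [hK, hδdef]; field_simp; ring
  have e1 : 4 * a * (-q) / m ≤ 4 * B * m * a := by
    rw [div_le_iff₀ hm0]
    have := mul_le_mul_of_nonneg_left hB (by positivity : 0 ≤ 4 * a)
    linarith
  have e2 : 8 / R ^ 2 * m ≤ 8 / R ^ 2 * m * a := le_mul_of_one_le_right (by positivity) ha1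
  rw [e]
  linarith

/-- The constant in `propagating_bound`. -/
def propagatingConst (R q₀ q₁ c₀ : ℝ) : ℝ :=
  q₁ ^ 2 * ((27 / (2 * q₀) + 9 * R ^ 2 / 2) * (1 / c₀ + 4 * R)) / (2 * R ^ 2)
    + 1 / (2 * R ^ 3 * c₀)

/-- Turns the degenerate coefficient of |w|² in the imaginary energy into the weight r - R that
occurs in `hardy`, at the price of a factor |α(2R)|⁻² from |F| ≤ 3R |α(2R)|. -/
theorem weighted_w_le {r : ℝ} (hc : 0 < c) (hR : 0 < R) (hr : R ≤ r) (hr2 : r ≤ 2 * R) :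
    2 * c / (9 * R * ‖alphaPoly c R (2 * R)‖ ^ 2) * (r - R)
      ≤ (alphaPoly c R r / stretchPoly c R r).im := by
  have ha1 : 1 ≤ ‖alphaPoly c R (2 * R)‖ := one_le_norm_alphaPoly hc (by linarith)
  have hx : 0 ≤ r - R := by linarith
  have hF := norm_stretchPoly_le hc hR hr hr2
  have hF0 : 0 < ‖stretchPoly c R r‖ := norm_pos_iff.2 (stretchPoly_ne_zero hc hR)
  rw [div_im_eq, le_div_iff₀ (by positivity)]
  set a := ‖alphaPoly c R (2 * R)‖
  calc 2 * c / (9 * R * a ^ 2) * (r - R) * ‖stretchPoly c R r‖ ^ 2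
      ≤ 2 * c / (9 * R * a ^ 2) * (r - R) * (3 * R * a) ^ 2 := by gcongr
    _ = c * (r - R) * (2 * R) := by field_simp; ring
    _ ≤ c * (r - R) * (r + R) := by gcongr; linarith

/-- The Hardy inequality trades the missing weight near R for the degenerate energy, which is
bounded by |p(R)|. -/
theorem integral_cutoff_mul_le (hc : 0 < c) (hR : 0 < R) (h : ModeSystem c R q w p)
    {ρ q₀ c₀ : ℝ} (hq₀ : 0 < q₀) (hq : q₀ ≤ q) (hc₀ : 0 < c₀) (hcc : c₀ ≤ c)
    (hρR : 2 * R ≤ ρ) (hw : w R = 1) (hρ : w ρ = 0) :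
    ∫ r in R..(R + R), cutoff R R r * ‖w r‖ ^ 2
      ≤ (27 / (2 * q₀) + 9 * R ^ 2 / 2) * (1 / c₀ + 4 * R) * ‖alphaPoly c R (2 * R)‖ ^ 2
        * ‖p R‖ := by
  set a := ‖alphaPoly c R (2 * R)‖ with ha
  have ha1 : 1 ≤ a := one_le_norm_alphaPoly hc (by linarith)
  have hq0 : 0 < q := by linarith
  have hS := (contDiff_product (c := c) (R := R)).continuous
  have hwc := h.continuous_w
  have hpc := h.continuous_p
  -- Here the lower bound c₀ of c enters: a ≤ 1 + 4cR, so a/c stays bounded and a³/c costs only a².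
  have hac : a ≤ (1 / c₀ + 4 * R) * c := by
    have h1 := norm_alphaPoly_le (R := R) (r := 2 * R) hc (by linarith)
    have h2 : 1 ≤ 1 / c₀ * c := by rw [one_div, le_inv_mul_iff₀ hc₀]; linarith
    linarith
  set K₁ := 27 / (2 * q₀) + 9 * R ^ 2 / 2 with hK₁
  have hGc := continuous_imDensity hc hR h
  have hle : K₁ * a ^ 3 / c ≤ K₁ * (1 / c₀ + 4 * R) * a ^ 2 := by
    rw [div_le_iff₀ hc]
    have := mul_le_mul_of_nonneg_left hac (by positivity : 0 ≤ K₁ * a ^ 2)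
    linarith
  -- The Young parameter s = a/R balances the two terms: each becomes a multiple of a³/c times its
  -- part of the energy, with 27/(2q) from w and 9R²/2 from p.
  have h2 : ∫ r in R..(R + R), ((2 / R + a / R) * ((r - R) * ‖w r‖ ^ 2)
        + ‖alphaPoly c R r * stretchPoly c R r‖ ^ 2 / (a / R) * ((r - R) * ‖p r‖ ^ 2))
      ≤ ∫ r in R..(R + R), K₁ * a ^ 3 / c * imDensity c R q w p r := by
    refine intervalIntegral.integral_mono_on (by linarith) ?_ ?_ fun r hr => ?_
    · apply Continuous.intervalIntegrable
      exact (continuous_const.mul ((by fun_prop : Continuous fun r : ℝ => r - R).mul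
        (hwc.norm.pow 2))).add (((hS.norm.pow 2).div_const _).mul
          ((by fun_prop : Continuous fun r : ℝ => r - R).mul (hpc.norm.pow 2)))
    · exact (continuous_const.mul hGc).intervalIntegrable _ _
    · have hx : 0 ≤ r - R := by linarith [hr.1]
      have hr2 : r ≤ 2 * R := by linarith [hr.2]
      have hQ := weighted_w_le hc hR hr.1 hr2
      rw [← ha] at hQ
      have hSi := mul_im_ge hc hR hr.1
      have hSn : ‖alphaPoly c R r * stretchPoly c R r‖ ≤ 3 * R * a ^ 2 := by
        rw [norm_mul]
        have h1 := norm_alphaPoly_mono hc hr.1 hr2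
        have h2 := norm_stretchPoly_le hc hR hr.1 hr2
        calc _ ≤ a * (3 * R * a) := by gcongr
          _ = _ := by ring
      set Qi := (alphaPoly c R r / stretchPoly c R r).im
      set Si := (alphaPoly c R r * stretchPoly c R r).im
      have i1 : (2 / R + a / R) * ((r - R) * ‖w r‖ ^ 2)
          ≤ K₁ * a ^ 3 / c * (q * Qi * ‖w r‖ ^ 2) := by
        have j1 : (2 / R + a / R) * (r - R) ≤ 3 * a / R * (r - R) := by
          gcongr
          rw [← add_div]; gcongr; linarith
        have j2 : 3 * a / R * (r - R) ≤ K₁ * a ^ 3 / c * (q * Qi) := by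
          calc 3 * a / R * (r - R)
              = 27 / (2 * q) * a ^ 3 / c * (q * (2 * c / (9 * R * a ^ 2) * (r - R))) := by
                field_simp; ring
            _ ≤ K₁ * a ^ 3 / c * (q * Qi) := by
                have : 27 / (2 * q) ≤ K₁ := by
                  have : 27 / (2 * q) ≤ 27 / (2 * q₀) := by gcongr
                  have : 0 ≤ 9 * R ^ 2 / 2 := by positivity
                  linarith
                gcongr
        calc _ = (2 / R + a / R) * (r - R) * ‖w r‖ ^ 2 := by ring
          _ ≤ K₁ * a ^ 3 / c * (q * Qi) * ‖w r‖ ^ 2 :=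
              mul_le_mul_of_nonneg_right (j1.trans j2) (sq_nonneg _)
          _ = _ := by ring
      have i2 : ‖alphaPoly c R r * stretchPoly c R r‖ ^ 2 / (a / R) * ((r - R) * ‖p r‖ ^ 2)
          ≤ K₁ * a ^ 3 / c * (Si * ‖p r‖ ^ 2) := by
        calc _ ≤ (3 * R * a ^ 2) ^ 2 / (a / R) * ((r - R) * ‖p r‖ ^ 2) := by gcongr
          _ = 9 * R ^ 2 / 2 * a ^ 3 / c * (2 * c * (r - R) * R * ‖p r‖ ^ 2) := by
              field_simp; ring
          _ ≤ K₁ * a ^ 3 / c * (Si * ‖p r‖ ^ 2) := by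
              have : 9 * R ^ 2 / 2 ≤ K₁ := by
                have : 0 ≤ 27 / (2 * q₀) := by positivity
                linarith
              gcongr
      have : imDensity c R q w p r = q * Qi * ‖w r‖ ^ 2 + Si * ‖p r‖ ^ 2 := rfl
      rw [this, mul_add]
      exact add_le_add i1 i2
  have h3 := integral_imDensity_le hc hR h hq0.le (s := R + R) (by linarith) (by linarith) hw hρ
  rw [intervalIntegral.integral_const_mul] at h2
  refine (hardy h hR (by positivity : 0 < a / R)).trans (h2.trans ?_)
  calc _ ≤ K₁ * a ^ 3 / c * ‖p R‖ := by gcongr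
    _ ≤ _ := by gcongr

theorem two_mul_le_inv_add {τ : ℝ} (hτ : 0 < τ) (y : ℝ) : 2 * y ≤ 1 / τ + τ * y ^ 2 := by
  have h := sq_nonneg (1 - τ * y)
  have e : 1 / τ + τ * y ^ 2 = (1 + (τ * y) ^ 2) / τ := by field_simp
  rw [e, le_div_iff₀ hτ]
  nlinarith

theorem propagating_w_term (hc : 0 < c) (hR : 0 < R) {q₁ r τ : ℝ} (hq : 0 < q) (hq₁ : q ≤ q₁)
    (hτ : 0 < τ) (hr : r ∈ Icc R (R + R)) :
    |q| * ‖alphaPoly c R r / stretchPoly c R r‖ * ‖w r‖ * cutoff R R r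
      ≤ 1 / (2 * τ) + τ * q₁ ^ 2 * ‖alphaPoly c R (2 * R)‖ ^ 2 / (2 * R ^ 2)
        * (cutoff R R r * ‖w r‖ ^ 2) := by
  obtain ⟨hg0, hg1⟩ := cutoff_mem hR hr
  have hF := le_norm_stretchPoly hc hr.1
  have hA := norm_alphaPoly_mono hc hr.1 (by linarith [hr.2] : r ≤ 2 * R)
  set a := ‖alphaPoly c R (2 * R)‖
  have ha : 0 ≤ a := norm_nonneg _
  have hQn : ‖alphaPoly c R r / stretchPoly c R r‖ ≤ a / R := by
    rw [norm_div]; gcongr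
  have hq1 : 0 ≤ q₁ := by linarith
  have j1 : q * ‖alphaPoly c R r / stretchPoly c R r‖ * ‖w r‖ ≤ q₁ * (a / R) * ‖w r‖ := by
    gcongr
  have j2 := two_mul_le_inv_add hτ (q₁ * (a / R) * ‖w r‖)
  have j3 : q * ‖alphaPoly c R r / stretchPoly c R r‖ * ‖w r‖
      ≤ (1 / τ + τ * (q₁ * (a / R) * ‖w r‖) ^ 2) / 2 := by linarith
  rw [abs_of_pos hq]
  have j4 := mul_le_mul_of_nonneg_right j3 hg0
  have j5 : 1 / τ / 2 * cutoff R R r ≤ 1 / τ / 2 :=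
    mul_le_of_le_one_right (by positivity) hg1
  have e1 : 1 / (2 * τ) = 1 / τ / 2 := by rw [div_div, mul_comm]
  have e2 : (τ * (q₁ * (a / R) * ‖w r‖) ^ 2) / 2 * cutoff R R r
      = τ * q₁ ^ 2 * a ^ 2 / (2 * R ^ 2) * (cutoff R R r * ‖w r‖ ^ 2) := by
    rw [mul_pow, mul_pow, div_pow]; field_simp
  rw [e1, ← e2]
  linarith

/-- The derivative of the cutoff supplies exactly the weight r - R with which |p|² is controlled by
the imaginary energy, so no Hardy inequality is needed for this term. -/
theorem propagating_p_term (hc : 0 < c) (hR : 0 < R) {c₀ r τ : ℝ} (hq : 0 < q) (hc₀ : 0 < c₀)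
    (hcc : c₀ ≤ c) (hτ : 0 < τ) (hr : r ∈ Icc R (R + R)) :
    2 * (r - R) / R ^ 2 * ‖p r‖
      ≤ 1 / (R * τ) + τ / (2 * R ^ 3 * c₀) * imDensity c R q w p r := by
  have hx : 0 ≤ r - R := by linarith [hr.1]
  have hxR : r - R ≤ R := by linarith [hr.2]
  have hSi := mul_im_ge hc hR hr.1
  have hQi := div_im_nonneg hc hR hr.1
  have j1 := two_mul_le_inv_add hτ ‖p r‖
  have j2 : (r - R) / R ^ 2 * (1 / τ) ≤ 1 / (R * τ) := by
    have : (r - R) / R ^ 2 ≤ 1 / R := by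
      rw [div_le_div_iff₀ (by positivity) hR]; nlinarith
    calc _ ≤ 1 / R * (1 / τ) := by gcongr
      _ = _ := by field_simp
  have j3 : (r - R) * ‖p r‖ ^ 2 ≤ 1 / (2 * R * c₀) * imDensity c R q w p r := by
    have k1 : 2 * c₀ * (r - R) * R * ‖p r‖ ^ 2 ≤ imDensity c R q w p r := by
      unfold imDensity
      have k2 : 0 ≤ q * (alphaPoly c R r / stretchPoly c R r).im * ‖w r‖ ^ 2 := by positivity
      have k3 : 2 * c₀ * (r - R) * R * ‖p r‖ ^ 2
          ≤ (alphaPoly c R r * stretchPoly c R r).im * ‖p r‖ ^ 2 := by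
        refine mul_le_mul_of_nonneg_right (le_trans ?_ hSi) (sq_nonneg _)
        gcongr
      linarith
    rw [one_div, le_inv_mul_iff₀ (by positivity)]
    linarith
  calc 2 * (r - R) / R ^ 2 * ‖p r‖ = (r - R) / R ^ 2 * (2 * ‖p r‖) := by ring
    _ ≤ (r - R) / R ^ 2 * (1 / τ + τ * ‖p r‖ ^ 2) := by gcongr
    _ = (r - R) / R ^ 2 * (1 / τ) + τ / R ^ 2 * ((r - R) * ‖p r‖ ^ 2) := by ring
    _ ≤ 1 / (R * τ) + τ / R ^ 2 * (1 / (2 * R * c₀) * imDensity c R q w p r) := by gcongr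
    _ = _ := by field_simp

/-- The Neumann datum of a propagating mode. -/
theorem propagating_bound (hc : 0 < c) (hR : 0 < R) (h : ModeSystem c R q w p)
    {ρ q₀ q₁ c₀ : ℝ} (hq₀ : 0 < q₀) (hq : q₀ ≤ q) (hq₁ : q ≤ q₁) (hc₀ : 0 < c₀) (hcc : c₀ ≤ c)
    (hρR : 2 * R ≤ ρ) (hw : w R = 1) (hρ : w ρ = 0) :
    ‖p R‖ ≤ (2 * R + 4) * propagatingConst R q₀ q₁ c₀ * ‖alphaPoly c R (2 * R)‖ ^ 4 := by
  have hH := integral_cutoff_mul_le hc hR h hq₀ hq hc₀ hcc hρR hw hρ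
  set K₁ := (27 / (2 * q₀) + 9 * R ^ 2 / 2) * (1 / c₀ + 4 * R) with hK₁
  have hK₁0 : 0 < K₁ := by positivity
  set K₂ := propagatingConst R q₀ q₁ c₀ with hK₂
  have hK₂e : K₂ = q₁ ^ 2 * K₁ / (2 * R ^ 2) + 1 / (2 * R ^ 3 * c₀) := rfl
  have hK₂0 : 0 < K₂ := by rw [hK₂e]; positivity
  set a := ‖alphaPoly c R (2 * R)‖ with ha
  have ha1 : 1 ≤ a := one_le_norm_alphaPoly hc (by linarith)
  have hq0 : 0 < q := by linarith
  -- Makes the total coefficient of ‖p R‖ on the right equal to 1/2. The fourth power is a² from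
  -- |α/F|² ≤ (a/R)² times a² from `integral_cutoff_mul_le`.
  set τ := 1 / (2 * K₂ * a ^ 4) with hτ
  have hτ0 : 0 < τ := by positivity
  have hQ := (contDiff_ratio hc hR).continuous
  have hwc := h.continuous_w
  have hpc := h.continuous_p
  have hg := continuous_cutoff (R := R) (δ := R)
  have hGc := continuous_imDensity hc hR h
  have h2 : ∫ r in R..(R + R), (|q| * ‖alphaPoly c R r / stretchPoly c R r‖ * ‖w r‖ * cutoff R R r
      + 2 * (r - R) / R ^ 2 * ‖p r‖) ≤ ∫ r in R..(R + R), ((1 / (2 * τ) + 1 / (R * τ)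
        + τ * q₁ ^ 2 * a ^ 2 / (2 * R ^ 2) * (cutoff R R r * ‖w r‖ ^ 2))
        + τ / (2 * R ^ 3 * c₀) * imDensity c R q w p r) := by
    refine intervalIntegral.integral_mono_on (by linarith) ?_ ?_ fun r hr => ?_
    · apply Continuous.intervalIntegrable
      exact (((continuous_const.mul hQ.norm).mul hwc.norm).mul hg).add
        ((by fun_prop : Continuous fun r : ℝ => 2 * (r - R) / R ^ 2).mul hpc.norm)
    · apply Continuous.intervalIntegrable
      exact (continuous_const.add (continuous_const.mul (hg.mul (hwc.norm.pow 2)))).add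
        (continuous_const.mul hGc)
    · have i1 := propagating_w_term (w := w) hc hR hq0 hq₁ hτ0 hr
      have i2 := propagating_p_term (w := w) (p := p) hc hR hq0 hc₀ hcc hτ0 hr
      rw [← ha] at i1
      linarith
  have h3 := integral_imDensity_le hc hR h hq0.le (s := R + R) (by linarith) (by linarith) hw hρ
  replace h2 := (norm_p_le hc hR h hR).trans h2
  rw [intervalIntegral.integral_add, intervalIntegral.integral_add,
    intervalIntegral.integral_const, intervalIntegral.integral_const_mul,
    intervalIntegral.integral_const_mul, smul_eq_mul] at h2
  rotate_left
  · simp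
  · exact (continuous_const.mul (hg.mul (hwc.norm.pow 2))).intervalIntegrable _ _
  · exact (continuous_const.add
      (continuous_const.mul (hg.mul (hwc.norm.pow 2)))).intervalIntegrable _ _
  · exact (continuous_const.mul hGc).intervalIntegrable _ _
  have h4 : τ * q₁ ^ 2 * a ^ 2 / (2 * R ^ 2) * (∫ r in R..(R + R), cutoff R R r * ‖w r‖ ^ 2)
      ≤ τ * q₁ ^ 2 * a ^ 2 / (2 * R ^ 2) * (K₁ * a ^ 2 * ‖p R‖) := by gcongr
  have h5 : τ / (2 * R ^ 3 * c₀) * (∫ r in R..(R + R), imDensity c R q w p r)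
      ≤ τ * a ^ 4 / (2 * R ^ 3 * c₀) * ‖p R‖ := by
    have : 1 ≤ a ^ 4 := one_le_pow₀ ha1
    have : τ ≤ τ * a ^ 4 := le_mul_of_one_le_right hτ0.le this
    refine (mul_le_mul_of_nonneg_left h3 (by positivity)).trans ?_
    gcongr
  have h6 : τ * q₁ ^ 2 * a ^ 2 / (2 * R ^ 2) * (K₁ * a ^ 2 * ‖p R‖)
      + τ * a ^ 4 / (2 * R ^ 3 * c₀) * ‖p R‖ = τ * K₂ * a ^ 4 * ‖p R‖ := by
    rw [hK₂e]; ring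
  have h7 : τ * K₂ * a ^ 4 = 1 / 2 := by rw [hτ]; field_simp
  have h8 : (R + R - R) * (1 / (2 * τ) + 1 / (R * τ)) = (R + 2) * K₂ * a ^ 4 := by
    rw [hτ]; field_simp; ring
  rw [h7] at h6
  rw [h8] at h2
  have h9 : ‖p R‖ ≤ (R + 2) * K₂ * a ^ 4 + 1 / 2 * ‖p R‖ := by linarith
  linarith

end ModeSystem

/-! ### Energy estimates that make the mode series converge. -/

/-- Energy estimate for evanescent modes. -/
theorem ModeSystem.exists_energy_bound {c R ρ : ℝ} (hc : 0 < c) (hR : 0 < R) (hρR : 2 * R ≤ ρ) :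
    ∃ K : ℝ, 0 ≤ K ∧ ∀ (q : ℝ) (w p : ℝ → ℂ), ModeSystem c R q w p → q ≤ 0 → w R = 1 → w ρ = 0 →
      (∫ r in R..ρ, ‖alphaPoly c R r * stretchPoly c R r * p r‖ ^ 2) ≤ K * ‖p R‖ ∧
      -q * (∫ r in R..ρ, ‖w r‖ ^ 2) ≤ K * ‖p R‖ := by
  have hRρ : R ≤ ρ := by linarith
  have hS := (contDiff_product (c := c) (R := R)).continuous
  have hF := (contDiff_stretchPoly (c := c) (R := R)).continuous
  obtain ⟨M₁, hM₁⟩ := (isCompact_Icc (a := R) (b := ρ)).exists_bound_of_continuousOn hS.continuousOn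
  obtain ⟨M₂, hM₂⟩ := (isCompact_Icc (a := R) (b := ρ)).exists_bound_of_continuousOn hF.continuousOn
  -- K may depend on c and ρ but not on q: it serves only the summability of the series, not the
  -- final operator bound.
  refine ⟨M₁ ^ 2 / R + M₂ ^ 2 / R, by positivity, fun q w p h hq hw hρ => ?_⟩
  have hG := ModeSystem.integral_reDensity_le hc hR h hq hRρ le_rfl hw hρ
  have hwc := h.continuous_w
  have hpc := h.continuous_p
  have hGc := ModeSystem.continuous_reDensity hc hR h
  have hk1 : 0 ≤ M₁ ^ 2 / R * ‖p R‖ := by positivity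
  have hk2 : 0 ≤ M₂ ^ 2 / R * ‖p R‖ := by positivity
  constructor
  · have : ∫ r in R..ρ, ‖alphaPoly c R r * stretchPoly c R r * p r‖ ^ 2
        ≤ ∫ r in R..ρ, M₁ ^ 2 / R * ModeSystem.reDensity c R q w p r := by
      refine intervalIntegral.integral_mono_on hRρ
        (((hS.mul hpc).norm.pow 2).intervalIntegrable _ _)
        ((continuous_const.mul hGc).intervalIntegrable _ _) fun r hr => ?_
      have h1 := mul_re_ge hc hR hr.1
      have h2 := ModeSystem.div_re_nonneg hc hR hr.1
      have h3 : R * ‖p r‖ ^ 2 ≤ ModeSystem.reDensity c R q w p r := by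
        unfold ModeSystem.reDensity
        have : 0 ≤ -q * (alphaPoly c R r / stretchPoly c R r).re * ‖w r‖ ^ 2 := by
          have : 0 ≤ -q := by linarith
          positivity
        have := mul_le_mul_of_nonneg_right h1 (sq_nonneg ‖p r‖)
        linarith
      rw [norm_mul, mul_pow]
      calc _ ≤ M₁ ^ 2 * ‖p r‖ ^ 2 := by
            gcongr
            exact hM₁ r hr
        _ = M₁ ^ 2 / R * (R * ‖p r‖ ^ 2) := by field_simp
        _ ≤ _ := by gcongr
    rw [intervalIntegral.integral_const_mul] at this
    have := mul_le_mul_of_nonneg_left hG (by positivity : 0 ≤ M₁ ^ 2 / R)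
    linarith
  · have : ∫ r in R..ρ, -q * ‖w r‖ ^ 2
        ≤ ∫ r in R..ρ, M₂ ^ 2 / R * ModeSystem.reDensity c R q w p r := by
      refine intervalIntegral.integral_mono_on hRρ
        ((continuous_const.mul (hwc.norm.pow 2)).intervalIntegrable _ _)
        ((continuous_const.mul hGc).intervalIntegrable _ _) fun r hr => ?_
      have h1 := hR.le.trans (mul_re_ge hc hR hr.1)
      have h2 := div_re_ge hc hR hr.1
      have h3 := alphaPoly_re_ge hc hr.1
      have hF0 : 0 < ‖stretchPoly c R r‖ := norm_pos_iff.2 (stretchPoly_ne_zero hc hR)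
      have hq' : 0 ≤ -q := by linarith
      have h4 : R ≤ M₂ ^ 2 * (alphaPoly c R r / stretchPoly c R r).re := by
        rw [div_le_iff₀ (by positivity)] at h2
        have h5 : ‖stretchPoly c R r‖ ^ 2 ≤ M₂ ^ 2 := by gcongr; exact hM₂ r hr
        have h6 := mul_le_mul_of_nonneg_left h5 (ModeSystem.div_re_nonneg hc hR hr.1)
        have h7 := mul_le_mul_of_nonneg_right h3 hR.le
        linarith
      have h5 : (-q) * (alphaPoly c R r / stretchPoly c R r).re * ‖w r‖ ^ 2
          ≤ ModeSystem.reDensity c R q w p r := by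
        unfold ModeSystem.reDensity
        have : 0 ≤ (alphaPoly c R r * stretchPoly c R r).re * ‖p r‖ ^ 2 := by positivity
        linarith
      calc -q * ‖w r‖ ^ 2 = -q * ‖w r‖ ^ 2 * R / R := by field_simp
        _ ≤ -q * ‖w r‖ ^ 2 * (M₂ ^ 2 * (alphaPoly c R r / stretchPoly c R r).re) / R := by gcongr
        _ = M₂ ^ 2 / R * ((-q) * (alphaPoly c R r / stretchPoly c R r).re * ‖w r‖ ^ 2) := by ring
        _ ≤ _ := by gcongr
    rw [intervalIntegral.integral_const_mul, intervalIntegral.integral_const_mul] at this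
    have := mul_le_mul_of_nonneg_left hG (by positivity : 0 ≤ M₂ ^ 2 / R)
    linarith

/-! ### Series of separated functions on the PML region -/

/-- The Lebesgue measure on the PML region. -/
abbrev regionMeasure (R ρ Z : ℝ) : Measure (ℝ × ℝ) := volume.restrict (pmlRegion R ρ Z)

theorem regionMeasure_eq (R ρ Z : ℝ) : regionMeasure R ρ Z
    = (volume.restrict (Ioo R ρ)).prod (volume.restrict (Ioo 0 Z)) := by
  rw [regionMeasure, pmlRegion, Measure.volume_eq_prod, Measure.prod_restrict]

theorem measurableSet_pmlRegion (R ρ Z : ℝ) : MeasurableSet (pmlRegion R ρ Z) :=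
  measurableSet_Ioo.prod measurableSet_Ioo

instance (R ρ Z : ℝ) : IsFiniteMeasure (regionMeasure R ρ Z) := by
  rw [regionMeasure_eq]; infer_instance

theorem exists_bound_region {R ρ Z : ℝ} {u : ℝ × ℝ → ℂ} (hu : Continuous u) :
    ∃ C, ∀ᵐ x ∂(regionMeasure R ρ Z), ‖u x‖ ≤ C := by
  obtain ⟨C, hC⟩ := (isCompact_Icc.prod isCompact_Icc :
    IsCompact (Icc R ρ ×ˢ Icc 0 Z)).exists_bound_of_continuousOn hu.continuousOn
  refine ⟨C, ?_⟩
  filter_upwards [ae_restrict_mem (measurableSet_pmlRegion R ρ Z)] with x hx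
  exact hC x ⟨Ioo_subset_Icc_self hx.1, Ioo_subset_Icc_self hx.2⟩

theorem memLp_region {R ρ Z : ℝ} {u : ℝ × ℝ → ℂ} (hu : Continuous u) (p : ℝ≥0∞) :
    MemLp u p (regionMeasure R ρ Z) := by
  obtain ⟨C, hC⟩ := exists_bound_region (R := R) (ρ := ρ) (Z := Z) hu
  exact MemLp.of_bound hu.aestronglyMeasurable C hC

theorem integrable_region {R ρ Z : ℝ} {u : ℝ × ℝ → ℂ} (hu : Continuous u) :
    Integrable u (regionMeasure R ρ Z) :=
  memLp_one_iff_integrable.1 (memLp_region hu 1)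

theorem memLp_continuous_mul {R ρ Z : ℝ} {u v : ℝ × ℝ → ℂ} (hu : Continuous u)
    (hv : MemLp v 2 (regionMeasure R ρ Z)) :
    MemLp (fun x => u x * v x) 2 (regionMeasure R ρ Z) :=
  hv.mul (memLp_region hu ∞)

theorem integral_region_separated {R ρ Z : ℝ} (f g : ℝ → ℂ) :
    ∫ x, f x.1 * g x.2 ∂(regionMeasure R ρ Z) = (∫ r in Ioo R ρ, f r) * ∫ z in Ioo 0 Z, g z := by
  rw [regionMeasure_eq, integral_prod_mul]

/-- A series of orthogonal separated functions with summable squared norms converges weakly. -/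
theorem exists_separated_series {R ρ Z L : ℝ} (f : ℕ → ℝ → ℂ) (s : ℕ → ℝ → ℝ)
    (hf : ∀ n, Continuous (f n)) (hs : ∀ n, Continuous (s n))
    (horth : ∀ m n, ∫ z in Ioo 0 Z, s m z * s n z = if m = n then L else 0)
    (hsum : Summable fun n => ∫ r in Ioo R ρ, ‖f n r‖ ^ 2) :
    ∃ W : ℝ × ℝ → ℂ, MemLp W 2 (regionMeasure R ρ Z) ∧
      ∀ h : ℝ × ℝ → ℂ, MemLp h 2 (regionMeasure R ρ Z) →
        HasSum (fun n => ∫ x, f n x.1 * (s n x.2 : ℂ) * h x ∂(regionMeasure R ρ Z))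
          (∫ x, W x * h x ∂(regionMeasure R ρ Z)) := by
  have hmem : ∀ n, MemLp (fun x : ℝ × ℝ => f n x.1 * (s n x.2 : ℂ)) 2 (regionMeasure R ρ Z) :=
    fun n => memLp_region (((hf n).comp continuous_fst).mul
      (Complex.continuous_ofReal.comp ((hs n).comp continuous_snd))) 2
  let e : ℕ → Lp ℂ 2 (regionMeasure R ρ Z) := fun n => (hmem n).toLp _
  have hinner : ∀ m n, inner ℂ (e m) (e n)
      = (∫ r in Ioo R ρ, star (f m r) * f n r) * (if m = n then (L : ℂ) else 0) := by
    intro m n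
    have h1 : (if m = n then (L : ℂ) else 0) = ∫ z in Ioo 0 Z, ((s m z : ℂ) * (s n z : ℂ)) := by
      simp only [← Complex.ofReal_mul]
      rw [integral_complex_ofReal, horth]
      split_ifs <;> simp
    rw [h1, ← integral_region_separated, L2.inner_def]
    refine integral_congr_ae ?_
    filter_upwards [(hmem m).coeFn_toLp, (hmem n).coeFn_toLp] with x hx hy
    rw [hx, hy, RCLike.inner_apply]
    simp only [map_mul, Complex.conj_ofReal, Complex.star_def]
    ring
  have hnorm : ∀ n, ‖e n‖ ^ 2 = L * ∫ r in Ioo R ρ, ‖f n r‖ ^ 2 := by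
    intro n
    have h1 : ((‖e n‖ ^ 2 : ℝ) : ℂ) = inner ℂ (e n) (e n) := by
      rw [inner_self_eq_norm_sq_to_K]; push_cast; rfl
    have h2 : ∫ r in Ioo R ρ, star (f n r) * f n r
        = ((∫ r in Ioo R ρ, ‖f n r‖ ^ 2 : ℝ) : ℂ) := by
      rw [← integral_complex_ofReal]
      congr 1; ext r
      rw [Complex.star_def, Complex.conj_mul']; push_cast; rfl
    rw [hinner, if_pos rfl, h2] at h1
    have h3 : ‖e n‖ ^ 2 = (∫ r in Ioo R ρ, ‖f n r‖ ^ 2) * L := by exact_mod_cast h1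
    rw [h3, mul_comm]
  have hes : Summable e := by
    -- Orthogonality in z alone makes the separated functions orthogonal, so convergence in L²
    -- amounts to summable squared norms.
    have hV : OrthogonalFamily ℂ (fun n => (Submodule.span ℂ {e n} : Submodule ℂ _))
        fun n => (Submodule.span ℂ {e n}).subtypeₗᵢ := by
      refine OrthogonalFamily.of_pairwise fun m n hmn => ?_
      refine Submodule.isOrtho_span.2 ?_
      rintro _ rfl _ rfl
      rw [hinner, if_neg hmn, mul_zero]
    have := (hV.summable_iff_norm_sq_summable
      (fun n => ⟨e n, Submodule.mem_span_singleton_self _⟩)).2 (by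
        simp only [Submodule.coe_norm, hnorm]
        exact hsum.mul_left L)
    exact this
  obtain ⟨W, hW⟩ := hes
  refine ⟨W, Lp.memLp W, fun h hh => ?_⟩
  have hhs : MemLp (fun x => star (h x)) 2 (regionMeasure R ρ Z) := hh.star
  have key := hW.mapL (innerSL ℂ (hhs.toLp _))
  have e1 : ∀ v : Lp ℂ 2 (regionMeasure R ρ Z), ∀ u : ℝ × ℝ → ℂ,
      v =ᵐ[regionMeasure R ρ Z] u →
      innerSL ℂ (hhs.toLp _) v = ∫ x, u x * h x ∂(regionMeasure R ρ Z) := by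
    intro v u huv
    rw [innerSL_apply_apply, L2.inner_def]
    refine integral_congr_ae ?_
    filter_upwards [hhs.coeFn_toLp, huv] with x hx hx'
    rw [hx, hx', RCLike.inner_apply]
    simp
  rw [e1 W W (ae_eq_refl _)] at key
  have e2 : ∀ n, innerSL ℂ (hhs.toLp _) (e n)
      = ∫ x, f n x.1 * (s n x.2 : ℂ) * h x ∂(regionMeasure R ρ Z) :=
    fun n => e1 _ _ (hmem n).coeFn_toLp
  simpa only [e2] using key

theorem integral_region_deriv_fst {R ρ Z : ℝ} (hRρ : R ≤ ρ) {U u : ℝ × ℝ → ℂ} (hu : Continuous u)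
    (hd : ∀ r z, HasDerivAt (fun r => U (r, z)) (u (r, z)) r) :
    ∫ x, u x ∂(regionMeasure R ρ Z) = ∫ z in Ioo 0 Z, (U (ρ, z) - U (R, z)) := by
  have hi := integrable_region (R := R) (ρ := ρ) (Z := Z) hu
  rw [regionMeasure_eq] at hi ⊢
  rw [integral_prod_symm _ hi]
  congr 1; ext z
  rw [← integral_Ioc_eq_integral_Ioo, ← intervalIntegral.integral_of_le hRρ,
    intervalIntegral.integral_eq_sub_of_hasDerivAt (f := fun r => U (r, z)) (fun r _ => hd r z)
      (by apply Continuous.intervalIntegrable; fun_prop)]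

theorem integral_region_deriv_snd {R ρ Z : ℝ} (hZ : 0 ≤ Z) {U u : ℝ × ℝ → ℂ} (hu : Continuous u)
    (hd : ∀ r z, HasDerivAt (fun z => U (r, z)) (u (r, z)) z) :
    ∫ x, u x ∂(regionMeasure R ρ Z) = ∫ r in Ioo R ρ, (U (r, Z) - U (r, 0)) := by
  have hi := integrable_region (R := R) (ρ := ρ) (Z := Z) hu
  rw [regionMeasure_eq] at hi ⊢
  rw [integral_prod _ hi]
  congr 1; ext r
  rw [← integral_Ioc_eq_integral_Ioo, ← intervalIntegral.integral_of_le hZ,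
    intervalIntegral.integral_eq_sub_of_hasDerivAt (f := fun z => U (r, z)) (fun z _ => hd r z)
      (by apply Continuous.intervalIntegrable; fun_prop)]

theorem hasDerivAt_slice_fst {φ : ℝ × ℝ → ℂ} (hφ : ContDiff ℝ ∞ φ) (r z : ℝ) :
    HasDerivAt (fun r => φ (r, z)) (fderiv ℝ φ (r, z) (1, 0)) r :=
  ((hφ.differentiable (by simp)) (r, z)).hasFDerivAt.comp_hasDerivAt r
    ((hasDerivAt_id r).prodMk (hasDerivAt_const r z))

theorem hasDerivAt_slice_snd {φ : ℝ × ℝ → ℂ} (hφ : ContDiff ℝ ∞ φ) (r z : ℝ) :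
    HasDerivAt (fun z => φ (r, z)) (fderiv ℝ φ (r, z) (0, 1)) z :=
  ((hφ.differentiable (by simp)) (r, z)).hasFDerivAt.comp_hasDerivAt z
    ((hasDerivAt_const z r).prodMk (hasDerivAt_id z))

theorem continuous_fderiv_apply {φ : ℝ × ℝ → ℂ} (hφ : ContDiff ℝ ∞ φ) (v : ℝ × ℝ) :
    Continuous fun x => fderiv ℝ φ x v :=
  (hφ.continuous_fderiv (by simp)).clm_apply continuous_const

section Separated

variable {f f' : ℝ → ℂ} {s s' : ℝ → ℝ}

theorem contDiff_separated (hf : ContDiff ℝ ∞ f) (hs : ContDiff ℝ ∞ s) :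
    ContDiff ℝ ∞ fun x : ℝ × ℝ => f x.1 * (s x.2 : ℂ) :=
  (hf.comp contDiff_fst).mul (Complex.ofRealCLM.contDiff.comp (hs.comp contDiff_snd))

theorem fderiv_separated_fst (hf : ContDiff ℝ ∞ f) (hs : ContDiff ℝ ∞ s)
    (hf' : ∀ r, HasDerivAt f (f' r) r) (x : ℝ × ℝ) :
    fderiv ℝ (fun x : ℝ × ℝ => f x.1 * (s x.2 : ℂ)) x (1, 0) = f' x.1 * (s x.2 : ℂ) :=
  (hasDerivAt_slice_fst (contDiff_separated hf hs) x.1 x.2).unique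
    ((hf' x.1).mul_const (s x.2 : ℂ))

theorem fderiv_separated_snd (hf : ContDiff ℝ ∞ f) (hs : ContDiff ℝ ∞ s)
    (hs' : ∀ z, HasDerivAt s (s' z) z) (x : ℝ × ℝ) :
    fderiv ℝ (fun x : ℝ × ℝ => f x.1 * (s x.2 : ℂ)) x (0, 1) = f x.1 * (s' x.2 : ℂ) :=
  (hasDerivAt_slice_snd (contDiff_separated hf hs) x.1 x.2).unique
    ((hs' x.2).ofReal_comp.const_mul (f x.1))

theorem green_fst_separated {R ρ Z : ℝ} (hRρ : R ≤ ρ) (hf'c : Continuous f') (hs : Continuous s)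
    (hf' : ∀ r, HasDerivAt f (f' r) r) (hρ : f ρ = 0) {φ : ℝ × ℝ → ℂ} (hφ : ContDiff ℝ ∞ φ) :
    (∫ x, f x.1 * (s x.2 : ℂ) * fderiv ℝ φ x (1, 0) ∂(regionMeasure R ρ Z))
      + ∫ x, f' x.1 * (s x.2 : ℂ) * φ x ∂(regionMeasure R ρ Z)
      = -(f R * ∫ z in Ioo 0 Z, (s z : ℂ) * φ (R, z)) := by
  have hfc : Continuous f := continuous_iff_continuousAt.2 fun r => (hf' r).continuousAt
  have hφc := hφ.continuous
  have hφ1 := continuous_fderiv_apply hφ (1, 0)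
  have hsc : Continuous fun x : ℝ × ℝ => (s x.2 : ℂ) :=
    Complex.continuous_ofReal.comp (hs.comp continuous_snd)
  have c1 : Continuous fun x : ℝ × ℝ => f x.1 * (s x.2 : ℂ) * fderiv ℝ φ x (1, 0) :=
    ((hfc.comp continuous_fst).mul hsc).mul hφ1
  have c2 : Continuous fun x : ℝ × ℝ => f' x.1 * (s x.2 : ℂ) * φ x :=
    ((hf'c.comp continuous_fst).mul hsc).mul hφc
  have c3 : Continuous fun x : ℝ × ℝ => f x.1 * (s x.2 : ℂ) * fderiv ℝ φ x (1, 0)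
      + f' x.1 * (s x.2 : ℂ) * φ x := c1.add c2
  rw [← integral_add (integrable_region c1) (integrable_region c2),
    integral_region_deriv_fst hRρ (U := fun x => f x.1 * (s x.2 : ℂ) * φ x) c3]
  · simp only [hρ, zero_mul, zero_sub]
    rw [integral_neg, ← integral_const_mul]
    congr 2; ext z; ring
  · intro r z
    convert! ((hf' r).mul_const (s z : ℂ)).mul (hasDerivAt_slice_fst hφ r z) using 1
    ring

theorem green_snd_separated {R ρ Z : ℝ} (hZ : 0 ≤ Z) (hfc : Continuous f) (hs'c : Continuous s')
    (hs' : ∀ z, HasDerivAt s (s' z) z) (hs0 : s 0 = 0) (hsZ : s Z = 0) {φ : ℝ × ℝ → ℂ}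
    (hφ : ContDiff ℝ ∞ φ) :
    (∫ x, f x.1 * (s x.2 : ℂ) * fderiv ℝ φ x (0, 1) ∂(regionMeasure R ρ Z))
      + ∫ x, f x.1 * (s' x.2 : ℂ) * φ x ∂(regionMeasure R ρ Z) = 0 := by
  have hsc' : Continuous s := continuous_iff_continuousAt.2 fun r => (hs' r).continuousAt
  have hφc := hφ.continuous
  have hφ1 := continuous_fderiv_apply hφ (0, 1)
  have c1 : Continuous fun x : ℝ × ℝ => f x.1 * (s x.2 : ℂ) * fderiv ℝ φ x (0, 1) :=
    ((hfc.comp continuous_fst).mul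
      (Complex.continuous_ofReal.comp (hsc'.comp continuous_snd))).mul hφ1
  have c2 : Continuous fun x : ℝ × ℝ => f x.1 * (s' x.2 : ℂ) * φ x :=
    ((hfc.comp continuous_fst).mul
      (Complex.continuous_ofReal.comp (hs'c.comp continuous_snd))).mul hφc
  have c3 : Continuous fun x : ℝ × ℝ => f x.1 * (s x.2 : ℂ) * fderiv ℝ φ x (0, 1)
      + f x.1 * (s' x.2 : ℂ) * φ x := c1.add c2
  rw [← integral_add (integrable_region c1) (integrable_region c2),
    integral_region_deriv_snd hZ (U := fun x => f x.1 * (s x.2 : ℂ) * φ x) c3]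
  · simp [hs0, hsZ]
  · intro r z
    convert! (((hs' z).ofReal_comp.const_mul (f r))).mul (hasDerivAt_slice_snd hφ r z) using 1
    ring

end Separated

/-! ### Conjugation and Green's formulas for functions with a Dirichlet trace. -/

namespace HasDirichletTrace

variable {R ρ Z : ℝ} {w wr wz : ℝ × ℝ → ℂ} {g : ℝ → ℂ}

theorem star (h : HasDirichletTrace R ρ Z w wr wz g) :
    HasDirichletTrace R ρ Z (fun x => star (w x)) (fun x => star (wr x)) (fun x => star (wz x))
      (fun z => star (g z)) where
  memLp := h.memLp.star
  memLp_r := h.memLp_r.star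
  memLp_z := h.memLp_z.star
  green_r φ hφ := by
    have hφs : ContDiff ℝ ∞ fun x => (starRingEnd ℂ) (φ x) := Complex.conjCLE.contDiff.comp hφ
    have hd : ∀ x, fderiv ℝ (fun x => (starRingEnd ℂ) (φ x)) x (1, 0)
        = (starRingEnd ℂ) (fderiv ℝ φ x (1, 0)) := fun x =>
      (hasDerivAt_slice_fst hφs x.1 x.2).unique (hasDerivAt_slice_fst hφ x.1 x.2).star
    have h1 := congrArg (starRingEnd ℂ) (h.green_r _ hφs)
    rw [← integral_conj, map_neg, ← integral_conj] at h1
    simpa [hd] using h1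
  green_z φ hφ := by
    have hφs : ContDiff ℝ ∞ fun x => (starRingEnd ℂ) (φ x) := Complex.conjCLE.contDiff.comp hφ
    have hd : ∀ x, fderiv ℝ (fun x => (starRingEnd ℂ) (φ x)) x (0, 1)
        = (starRingEnd ℂ) (fderiv ℝ φ x (0, 1)) := fun x =>
      (hasDerivAt_slice_snd hφs x.1 x.2).unique (hasDerivAt_slice_snd hφ x.1 x.2).star
    have h1 := congrArg (starRingEnd ℂ) (h.green_z _ hφs)
    rw [← integral_conj] at h1
    simpa [hd] using h1

theorem green_r_split (h : HasDirichletTrace R ρ Z w wr wz g) {φ : ℝ × ℝ → ℂ}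
    (hφ : ContDiff ℝ ∞ φ) :
    (∫ x, fderiv ℝ φ x (1, 0) * w x ∂(regionMeasure R ρ Z))
      + ∫ x, φ x * wr x ∂(regionMeasure R ρ Z) = -∫ z in Ioo 0 Z, g z * φ (R, z) := by
  rw [← h.green_r φ hφ, ← integral_add]
  · congr 1; ext x; ring
  · exact (memLp_continuous_mul (continuous_fderiv_apply hφ _) h.memLp).integrable (by norm_num)
  · exact (memLp_continuous_mul hφ.continuous h.memLp_r).integrable (by norm_num)

theorem green_z_split (h : HasDirichletTrace R ρ Z w wr wz g) {φ : ℝ × ℝ → ℂ}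
    (hφ : ContDiff ℝ ∞ φ) :
    (∫ x, fderiv ℝ φ x (0, 1) * w x ∂(regionMeasure R ρ Z))
      + ∫ x, φ x * wz x ∂(regionMeasure R ρ Z) = 0 := by
  rw [← h.green_z φ hφ, ← integral_add]
  · congr 1; ext x; ring
  · exact (memLp_continuous_mul (continuous_fderiv_apply hφ _) h.memLp).integrable (by norm_num)
  · exact (memLp_continuous_mul hφ.continuous h.memLp_z).integrable (by norm_num)

end HasDirichletTrace

/-! ### The PML form and the transverse modes. -/

theorem stretch_eq {c R r : ℝ} (hr : R < r) : stretch c R r = stretchPoly c R r := by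
  unfold stretch chi stretchPoly
  rw [if_neg (not_le.2 hr)]

theorem alpha_eq {c R r : ℝ} (hr : R < r) : alpha c R r = alphaPoly c R r := by
  unfold alpha
  rw [← (hasDerivAt_stretchPoly (c := c)).deriv]
  refine Filter.EventuallyEq.deriv_eq ?_
  filter_upwards [lt_mem_nhds hr] with s hs
  exact stretch_eq hs

theorem mul_beta_eq {c R r : ℝ} (hR : 0 < R) (hr : R < r) :
    (r : ℂ) * beta c R r = stretchPoly c R r := by
  have : (r : ℂ) ≠ 0 := by exact_mod_cast (hR.trans hr).ne'
  rw [beta, stretch_eq hr, mul_div_cancel₀ _ this]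

/-- The coefficients of the form are scalars, so it is symmetric as a bilinear form. This takes the
place of self-adjointness, which fails for complex α and β. -/
theorem aPML_star_swap (k c R ρ Z : ℝ) (w wr wz v vr vz : ℝ × ℝ → ℂ) :
    aPML k c R ρ Z w wr wz (fun x => star (v x)) (fun x => star (vr x)) (fun x => star (vz x))
      = aPML k c R ρ Z v vr vz (fun x => star (w x)) (fun x => star (wr x))
          (fun x => star (wz x)) := by
  unfold aPML
  congr 1; ext x
  simp only [star_star]
  ring

/-- The transverse eigenfunction `sin (m π z / Z)`, `m = n + 1`. -/
def sinMode (Z : ℝ) (n : ℕ) (z : ℝ) : ℝ := Real.sin ((n + 1 : ℕ) * Real.pi * z / Z)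

/-- The function `cos (m π z / Z)`, `m = n + 1`. -/
def cosMode (Z : ℝ) (n : ℕ) (z : ℝ) : ℝ := Real.cos ((n + 1 : ℕ) * Real.pi * z / Z)

/-- The transverse frequency `m π / Z`, `m = n + 1`. -/
def freq (Z : ℝ) (n : ℕ) : ℝ := (n + 1 : ℕ) * Real.pi / Z

/-- The number `k_m² = k² - m² π² / Z²`, `m = n + 1`. -/
def modeSq (k Z : ℝ) (n : ℕ) : ℝ := k ^ 2 - ((n + 1 : ℕ) : ℝ) ^ 2 * Real.pi ^ 2 / Z ^ 2

theorem modeSq_eq (k Z : ℝ) (n : ℕ) : modeSq k Z n = k ^ 2 - freq Z n ^ 2 := by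
  unfold modeSq freq; ring

theorem contDiff_sinMode (Z : ℝ) (n : ℕ) : ContDiff ℝ ∞ (sinMode Z n) := by
  unfold sinMode; exact Real.contDiff_sin.comp (by fun_prop)

theorem contDiff_cosMode (Z : ℝ) (n : ℕ) : ContDiff ℝ ∞ (cosMode Z n) := by
  unfold cosMode; exact Real.contDiff_cos.comp (by fun_prop)

theorem hasDerivAt_sinMode (Z : ℝ) (n : ℕ) (z : ℝ) :
    HasDerivAt (sinMode Z n) (freq Z n * cosMode Z n z) z := by
  have h : HasDerivAt (fun z => (n + 1 : ℕ) * Real.pi * z / Z) (freq Z n) z := by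
    convert! ((hasDerivAt_id z).const_mul ((n + 1 : ℕ) * Real.pi)).div_const Z using 1
    simp [freq]
  convert! h.sin using 1
  simp only [cosMode]; ring

theorem hasDerivAt_cosMode (Z : ℝ) (n : ℕ) (z : ℝ) :
    HasDerivAt (cosMode Z n) (-(freq Z n * sinMode Z n z)) z := by
  have h : HasDerivAt (fun z => (n + 1 : ℕ) * Real.pi * z / Z) (freq Z n) z := by
    convert! ((hasDerivAt_id z).const_mul ((n + 1 : ℕ) * Real.pi)).div_const Z using 1
    simp [freq]
  convert! h.cos using 1
  simp only [sinMode]; ring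

theorem sinMode_zero (Z : ℝ) (n : ℕ) : sinMode Z n 0 = 0 := by simp [sinMode]

theorem sinMode_end {Z : ℝ} (hZ : 0 < Z) (n : ℕ) : sinMode Z n Z = 0 := by
  unfold sinMode
  rw [mul_div_assoc, div_self hZ.ne', mul_one, Real.sin_nat_mul_pi]

theorem integral_sinMode_mul {Z : ℝ} (hZ : 0 < Z) (n : ℕ) (h : ℝ → ℂ) :
    ∫ z in Ioo 0 Z, (sinMode Z n z : ℂ) * h z = (Z / 2 : ℂ) * sineCoeff Z (n + 1) h := by
  have hz : (Z : ℂ) ≠ 0 := by exact_mod_cast hZ.ne'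
  unfold sineCoeff
  rw [← mul_assoc, show (Z / 2 : ℂ) * (2 / Z) = 1 by field_simp, one_mul]
  congr 1; ext z; rw [sinMode, mul_comm]

/-- The form `aPML` of a mode against a function with homogeneous lateral boundary values. -/
theorem mode_form_eq {k c R ρ Z : ℝ} (hc : 0 < c) (hR : 0 < R) (hZ : 0 < Z) (n : ℕ)
    {w p : ℝ → ℂ} (h : ModeSystem c R (modeSq k Z n) w p) {V Vr Vz : ℝ × ℝ → ℂ} {g : ℝ → ℂ}
    (hV : HasDirichletTrace R ρ Z V Vr Vz g) :
    (∫ x, p x.1 * (sinMode Z n x.2 : ℂ) * Vr x ∂(regionMeasure R ρ Z))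
      + (∫ x, (alphaPoly c R x.1 / stretchPoly c R x.1) * (freq Z n * w x.1)
          * (cosMode Z n x.2 : ℂ) * Vz x ∂(regionMeasure R ρ Z))
      + (∫ x, (alphaPoly c R x.1 / stretchPoly c R x.1) * (-(k : ℂ) ^ 2 * w x.1)
          * (sinMode Z n x.2 : ℂ) * V x ∂(regionMeasure R ρ Z))
      = -(Z / 2 : ℂ) * (p R * sineCoeff Z (n + 1) g) := by
  have hQ := contDiff_ratio hc hR
  have hf2 : ContDiff ℝ ∞ fun r => alphaPoly c R r / stretchPoly c R r * (freq Z n * w r) :=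
    hQ.mul (contDiff_const.mul h.contDiff_w)
  -- All derivatives are put on the smooth mode: p sin and (α/F) w times the derivative of sin serve
  -- as test functions in the Green formulas of V. The volume terms then combine through q + freq² =
  -- k², and only the trace at R survives.
  have g1 := hV.green_r_split (contDiff_separated h.contDiff_p (contDiff_sinMode Z n))
  have g2 := hV.green_z_split (contDiff_separated hf2 (contDiff_cosMode Z n))
  simp only [fderiv_separated_fst h.contDiff_p (contDiff_sinMode Z n) h.deriv_p] at g1
  simp only [fderiv_separated_snd hf2 (contDiff_cosMode Z n) (hasDerivAt_cosMode Z n)] at g2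
  have hwc := h.continuous_w
  have hs := (contDiff_sinMode Z n).continuous
  have hc0 : Continuous fun x : ℝ × ℝ =>
      alphaPoly c R x.1 / stretchPoly c R x.1 * w x.1 * (sinMode Z n x.2 : ℂ) :=
    ((hQ.continuous.comp continuous_fst).mul (hwc.comp continuous_fst)).mul
      (Complex.continuous_ofReal.comp (hs.comp continuous_snd))
  set J := ∫ x, alphaPoly c R x.1 / stretchPoly c R x.1 * w x.1 * (sinMode Z n x.2 : ℂ) * V x
    ∂(regionMeasure R ρ Z) with hJ
  have e1 : ∫ x, -((modeSq k Z n : ℝ) : ℂ) * (alphaPoly c R x.1 / stretchPoly c R x.1) * w x.1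
      * (sinMode Z n x.2 : ℂ) * V x ∂(regionMeasure R ρ Z) = -(modeSq k Z n : ℂ) * J := by
    rw [hJ, ← integral_const_mul]; congr 1; ext x; ring
  have e2 : ∫ x, alphaPoly c R x.1 / stretchPoly c R x.1 * (freq Z n * w x.1)
      * ((-(freq Z n * sinMode Z n x.2) : ℝ) : ℂ) * V x ∂(regionMeasure R ρ Z)
      = -(freq Z n : ℂ) ^ 2 * J := by
    rw [hJ, ← integral_const_mul]; congr 1; ext x; push_cast; ring
  have e3 : ∫ x, (alphaPoly c R x.1 / stretchPoly c R x.1) * (-(k : ℂ) ^ 2 * w x.1)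
      * (sinMode Z n x.2 : ℂ) * V x ∂(regionMeasure R ρ Z) = -(k : ℂ) ^ 2 * J := by
    rw [hJ, ← integral_const_mul]; congr 1; ext x; ring
  have e4 : ∫ z in Ioo 0 Z, g z * (p R * (sinMode Z n z : ℂ))
      = (Z / 2 : ℂ) * (p R * sineCoeff Z (n + 1) g) := by
    rw [mul_left_comm, ← integral_sinMode_mul hZ, ← integral_const_mul]
    congr 1; ext z; ring
  rw [e1, e4] at g1
  rw [e2] at g2
  rw [e3]
  have e5 : (modeSq k Z n : ℂ) = (k : ℂ) ^ 2 - (freq Z n : ℂ) ^ 2 := by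
    rw [modeSq_eq]; push_cast; rfl
  rw [e5] at g1
  linear_combination g1 + g2

/-! ### Superposition of the modes. -/

/-- The solution of the Dirichlet problem as a series of modes. -/
theorem exists_modal_solution {k c R ρ Z : ℝ} (hc : 0 < c) (hR : 0 < R) (hRρ : R < ρ)
    (hZ : 0 < Z) (w p : ℕ → ℝ → ℂ) (hmode : ∀ n, ModeSystem c R (modeSq k Z n) (w n) (p n))
    (hw : ∀ n, w n R = 1) (hρ : ∀ n, w n ρ = 0) {g : ℝ → ℂ}
    (hg : MemLp g 2 (volume.restrict (Ioo 0 Z)))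
    (hsum₁ : Summable fun n => ∫ r in Ioo R ρ, ‖sineCoeff Z (n + 1) g * w n r‖ ^ 2)
    (hsum₂ : Summable fun n => ∫ r in Ioo R ρ,
      ‖sineCoeff Z (n + 1) g * (alphaPoly c R r * stretchPoly c R r * p n r)‖ ^ 2)
    (hsum₃ : Summable fun n => ∫ r in Ioo R ρ,
      ‖sineCoeff Z (n + 1) g * (freq Z n * w n r)‖ ^ 2) :
    ∃ W Wr Wz : ℝ × ℝ → ℂ, HasDirichletTrace R ρ Z W Wr Wz g ∧
      ∀ (V Vr Vz : ℝ × ℝ → ℂ) (h : ℝ → ℂ), HasDirichletTrace R ρ Z V Vr Vz h →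
        HasSum (fun n => -(Z / 2 : ℂ) * (p n R * sineCoeff Z (n + 1) g
            * star (sineCoeff Z (n + 1) h)))
          (aPML k c R ρ Z W Wr Wz V Vr Vz) := by
  have hQ := (contDiff_ratio hc hR).continuous
  have hS := (contDiff_product (c := c) (R := R)).continuous
  have hwc := fun n => (hmode n).continuous_w
  have hpc := fun n => (hmode n).continuous_p
  have hsc := fun n => (contDiff_sinMode Z n).continuous
  have hcc := fun n => (contDiff_cosMode Z n).continuous
  set b : ℕ → ℂ := fun n => sineCoeff Z (n + 1) g with hb
  obtain ⟨W, hW, hWs⟩ := exists_separated_series (fun n r => b n * w n r) (sinMode Z)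
    (fun n => continuous_const.mul (hwc n)) hsc (integral_sin_mul_sin hZ) hsum₁
  obtain ⟨Wr, hWr, hWrs⟩ := exists_separated_series
    (fun n r => b n * (alphaPoly c R r * stretchPoly c R r * p n r)) (sinMode Z)
    (fun n => continuous_const.mul (hS.mul (hpc n))) hsc (integral_sin_mul_sin hZ) hsum₂
  obtain ⟨Wz, hWz, hWzs⟩ := exists_separated_series
    (fun n r => b n * (freq Z n * w n r)) (cosMode Z)
    (fun n => continuous_const.mul (continuous_const.mul (hwc n))) hcc
    (integral_cos_mul_cos hZ) hsum₃
  -- W, Wr, Wz are three separate L² sums. Green's formulas hold mode by mode and pass to the limit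
  -- by weak convergence; Parseval on (0, Z) identifies the boundary term with the data g.
  refine ⟨W, Wr, Wz, ⟨hW, hWr, hWz, fun φ hφ => ?_, fun φ hφ => ?_⟩, fun V Vr Vz h hV => ?_⟩
  · have h1 := memLp_region (R := R) (ρ := ρ) (Z := Z) (continuous_fderiv_apply hφ (1, 0)) 2
    have h2 := memLp_region (R := R) (ρ := ρ) (Z := Z) hφ.continuous 2
    have key := (hWs _ h1).add (hWrs _ h2)
    have hslice : Continuous fun z : ℝ => φ (R, z) := hφ.continuous.comp (by fun_prop)
    have hφL : MemLp (fun z => φ (R, z)) 2 (volume.restrict (Ioo 0 Z)) := by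
      obtain ⟨C, hC⟩ := (isCompact_Icc (a := (0 : ℝ)) (b := Z)).exists_bound_of_continuousOn
        hslice.continuousOn
      refine MemLp.of_bound hslice.aestronglyMeasurable C ?_
      filter_upwards [ae_restrict_mem measurableSet_Ioo] with z hz
      exact hC z (Ioo_subset_Icc_self hz)
    have hterm : ∀ n, (∫ x, b n * w n x.1 * (sinMode Z n x.2 : ℂ) * fderiv ℝ φ x (1, 0)
          ∂(regionMeasure R ρ Z))
        + (∫ x, b n * (alphaPoly c R x.1 * stretchPoly c R x.1 * p n x.1) * (sinMode Z n x.2 : ℂ)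
          * φ x ∂(regionMeasure R ρ Z))
        = -((Z / 2 : ℂ) * (b n * sineCoeff Z (n + 1) fun z => φ (R, z))) := by
      intro n
      rw [green_fst_separated (f := fun r => b n * w n r)
        (f' := fun r => b n * (alphaPoly c R r * stretchPoly c R r * p n r)) hRρ.le
        (continuous_const.mul (hS.mul (hpc n))) (hsc n)
        (fun r => ((hmode n).deriv_w r).const_mul (b n)) (by simp [hρ]) hφ,
        integral_sinMode_mul hZ, hw]
      ring
    simp only [hterm] at key
    have h3 := (hasSum_sineCoeff_mul hZ hg hφL).neg
    exact (integral_add (hW.integrable_mul h1) (hWr.integrable_mul h2)).trans (key.unique h3)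
  · have h1 := memLp_region (R := R) (ρ := ρ) (Z := Z) (continuous_fderiv_apply hφ (0, 1)) 2
    have h2 := memLp_region (R := R) (ρ := ρ) (Z := Z) hφ.continuous 2
    have key := (hWs _ h1).add (hWzs _ h2)
    have hterm : ∀ n, (∫ x, b n * w n x.1 * (sinMode Z n x.2 : ℂ) * fderiv ℝ φ x (0, 1)
          ∂(regionMeasure R ρ Z))
        + (∫ x, b n * (freq Z n * w n x.1) * (cosMode Z n x.2 : ℂ)
          * φ x ∂(regionMeasure R ρ Z)) = 0 := by
      intro n
      rw [← green_snd_separated (R := R) (ρ := ρ) (f := fun r => b n * w n r)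
        (s' := fun z => freq Z n * cosMode Z n z) hZ.le
        (continuous_const.mul (hwc n)) (continuous_const.mul (hcc n))
        (hasDerivAt_sinMode Z n) (sinMode_zero Z n) (sinMode_end hZ n) hφ]
      congr 1
      refine integral_congr_ae (Filter.Eventually.of_forall fun x => ?_)
      push_cast
      ring
    simp only [hterm] at key
    exact (integral_add (hW.integrable_mul h1) (hWz.integrable_mul h2)).trans
      (key.unique hasSum_zero)
  · have hVs := hV.star
    have m0 : Continuous fun x : ℝ × ℝ => alphaPoly c R x.1 / stretchPoly c R x.1 :=
      hQ.comp continuous_fst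
    -- Every coefficient of the form is moved onto V, where it is a bounded multiplier, so that the
    -- three weak limits can be applied.
    have m1 : Continuous fun x : ℝ × ℝ => (alphaPoly c R x.1 * stretchPoly c R x.1)⁻¹ :=
      (hS.comp continuous_fst).inv₀ fun x =>
        mul_ne_zero alphaPoly_ne_zero (stretchPoly_ne_zero hc hR)
    have k1 := memLp_continuous_mul m1 hVs.memLp_r
    have k2 := memLp_continuous_mul m0 hVs.memLp_z
    have m3 : Continuous fun x : ℝ × ℝ =>
        alphaPoly c R x.1 / stretchPoly c R x.1 * -(k : ℂ) ^ 2 := m0.mul continuous_const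
    have k3 := memLp_continuous_mul m3 hVs.memLp
    have key := ((hWrs _ k1).add (hWzs _ k2)).add (hWs _ k3)
    have hint : aPML k c R ρ Z W Wr Wz V Vr Vz
        = ((∫ x, Wr x * ((alphaPoly c R x.1 * stretchPoly c R x.1)⁻¹ * star (Vr x))
            ∂(regionMeasure R ρ Z))
          + ∫ x, Wz x * (alphaPoly c R x.1 / stretchPoly c R x.1 * star (Vz x))
            ∂(regionMeasure R ρ Z))
          + ∫ x, W x * (alphaPoly c R x.1 / stretchPoly c R x.1 * -(k : ℂ) ^ 2 * star (V x))
            ∂(regionMeasure R ρ Z) := by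
      have i12 := (hWr.integrable_mul k1).add (hWz.integrable_mul k2)
      refine Eq.trans ?_ ((integral_add i12 (hW.integrable_mul k3)).trans (congrArg (· + _)
        (integral_add (hWr.integrable_mul k1) (hWz.integrable_mul k2))))
      refine integral_congr_ae ?_
      filter_upwards [ae_restrict_mem (measurableSet_pmlRegion R ρ Z)] with x hx
      rw [mul_beta_eq hR hx.1.1, alpha_eq hx.1.1]
      have n1 : alphaPoly c R x.1 ≠ 0 := alphaPoly_ne_zero
      have n2 : stretchPoly c R x.1 ≠ 0 := stretchPoly_ne_zero hc hR
      simp only [Pi.add_apply, Pi.mul_apply]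
      field_simp
      ring
    have hterm : ∀ n, ((∫ x, b n * (alphaPoly c R x.1 * stretchPoly c R x.1 * p n x.1)
            * (sinMode Z n x.2 : ℂ) * ((alphaPoly c R x.1 * stretchPoly c R x.1)⁻¹ * star (Vr x))
            ∂(regionMeasure R ρ Z))
          + ∫ x, b n * (freq Z n * w n x.1) * (cosMode Z n x.2 : ℂ)
            * (alphaPoly c R x.1 / stretchPoly c R x.1 * star (Vz x)) ∂(regionMeasure R ρ Z))
          + (∫ x, b n * w n x.1 * (sinMode Z n x.2 : ℂ)
            * (alphaPoly c R x.1 / stretchPoly c R x.1 * -(k : ℂ) ^ 2 * star (V x))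
            ∂(regionMeasure R ρ Z))
        = -(Z / 2 : ℂ) * (p n R * b n * star (sineCoeff Z (n + 1) h)) := by
      intro n
      have hm := congrArg (fun t => b n * t) (mode_form_eq hc hR hZ n (hmode n) hVs)
      simp only [mul_add, ← integral_const_mul, sineCoeff_star] at hm
      have e : -(Z / 2 : ℂ) * (p n R * b n * star (sineCoeff Z (n + 1) h))
          = b n * (-(Z / 2 : ℂ) * (p n R * star (sineCoeff Z (n + 1) h))) := by ring
      rw [e, ← hm]
      refine congrArg₂ _ (congrArg₂ _ (integral_congr_ae ?_) (integral_congr_ae ?_))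
        (integral_congr_ae ?_)
      · refine Filter.Eventually.of_forall fun x => ?_
        have n1 : alphaPoly c R x.1 ≠ 0 := alphaPoly_ne_zero
        have n2 : stretchPoly c R x.1 ≠ 0 := stretchPoly_ne_zero hc hR
        field_simp
      · exact Filter.Eventually.of_forall fun x => by ring
      · exact Filter.Eventually.of_forall fun x => by ring
    simp only [hterm] at key
    rw [hint]
    exact key

/-! ### Uniform mode bounds and solvability. -/

theorem kappa_nonneg (k Z : ℝ) : 0 ≤ kappa k Z := Real.iInf_nonneg fun _ => Real.sqrt_nonneg _

theorem kappa_sq_le (k Z : ℝ) (n : ℕ) : kappa k Z ^ 2 ≤ |modeSq k Z n| := by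
  have h : kappa k Z ≤ Real.sqrt |modeSq k Z n| :=
    ciInf_le (f := fun m : ℕ => Real.sqrt |k ^ 2 - ((m + 1 : ℕ) : ℝ) ^ 2 * Real.pi ^ 2 / Z ^ 2|)
      ⟨0, by rintro _ ⟨m, rfl⟩; exact Real.sqrt_nonneg _⟩ n
  calc kappa k Z ^ 2 ≤ Real.sqrt |modeSq k Z n| ^ 2 := by
        gcongr
        exact kappa_nonneg k Z
    _ = _ := Real.sq_sqrt (abs_nonneg _)

theorem kappa_pos {k Z c R : ℝ} (h : 1 ≤ kappa k Z * c * R) : 0 < kappa k Z := by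
  refine (kappa_nonneg k Z).lt_of_ne fun h0 => ?_
  rw [← h0] at h
  norm_num at h

/-- Bound of the Neumann data of all modes, uniform in the PML parameters. -/
theorem exists_mode_bound (R Z k : ℝ) (hR : 0 < R) :
    ∃ C : ℝ, 0 < C ∧ ∀ c ρ : ℝ, 0 < c → 2 * R ≤ ρ → 1 ≤ kappa k Z * c * R →
      ∀ (n : ℕ) (w p : ℝ → ℂ), ModeSystem c R (modeSq k Z n) w p → w R = 1 → w ρ = 0 →
        ‖p R‖ ≤ C * (n + 1 : ℕ) * ‖alphaPoly c R ρ‖ ^ 4 := by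
  set κ := kappa k Z with hκ
  set C₁ := 4 * (Real.pi ^ 2 / Z ^ 2) + 8 / R ^ 2 with hC₁
  -- For propagating modes κ² ≤ q ≤ k², and κχ₀R ≥ 1 says χ₀ ≥ 1/(κR). No PML parameter enters the
  -- constant.
  set C₂ := (2 * R + 4) * ModeSystem.propagatingConst R (κ ^ 2) (k ^ 2) (1 / (κ * R)) with hC₂
  have hC₁0 : 0 < C₁ := by positivity
  -- The absolute value is taken because positivity of κ is derived only later, from the condition
  -- on c.
  refine ⟨C₁ + |C₂|, by positivity, fun c ρ hc hρR hκc n w p h hw hρ => ?_⟩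
  have hκ0 : 0 < κ := kappa_pos hκc
  have hn : (1 : ℝ) ≤ (n + 1 : ℕ) := by exact_mod_cast Nat.succ_le_succ (Nat.zero_le n)
  have ha := norm_alphaPoly_mono (c := c) (R := R) hc (by linarith : R ≤ 2 * R) hρR
  have ha1 : 1 ≤ ‖alphaPoly c R (2 * R)‖ := one_le_norm_alphaPoly hc (by linarith)
  have ha4 : ‖alphaPoly c R (2 * R)‖ ^ 4 ≤ ‖alphaPoly c R ρ‖ ^ 4 := by gcongr
  rcases le_or_gt (modeSq k Z n) 0 with hq | hq
  · have hB : -modeSq k Z n ≤ Real.pi ^ 2 / Z ^ 2 * ((n + 1 : ℕ) : ℝ) ^ 2 := by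
      unfold modeSq
      have e : Real.pi ^ 2 / Z ^ 2 * ((n + 1 : ℕ) : ℝ) ^ 2
          = ((n + 1 : ℕ) : ℝ) ^ 2 * Real.pi ^ 2 / Z ^ 2 := by ring
      rw [e]
      nlinarith [sq_nonneg k]
    have h1 := ModeSystem.evanescent_bound hc hR h hq hρR hw hρ hn hB
    have h2 : ‖alphaPoly c R (2 * R)‖ ≤ ‖alphaPoly c R (2 * R)‖ ^ 4 :=
      le_self_pow₀ ha1 (by norm_num)
    calc _ ≤ C₁ * (n + 1 : ℕ) * ‖alphaPoly c R (2 * R)‖ := h1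
      _ ≤ (C₁ + |C₂|) * (n + 1 : ℕ) * ‖alphaPoly c R ρ‖ ^ 4 := by
          gcongr
          · linarith [abs_nonneg C₂]
          · exact h2.trans ha4
  · have hq₀ : κ ^ 2 ≤ modeSq k Z n := by
      have := kappa_sq_le k Z n
      rwa [abs_of_pos hq] at this
    have hq₁ : modeSq k Z n ≤ k ^ 2 := by
      rw [modeSq_eq]; linarith [sq_nonneg (freq Z n)]
    have hcc : 1 / (κ * R) ≤ c := by
      rw [div_le_iff₀ (by positivity)]; linarith
    have h1 := ModeSystem.propagating_bound hc hR h (by positivity : 0 < κ ^ 2) hq₀ hq₁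
      (by positivity) hcc hρR hw hρ
    calc _ ≤ C₂ * ‖alphaPoly c R (2 * R)‖ ^ 4 := h1
      _ ≤ |C₂| * (n + 1 : ℕ) * ‖alphaPoly c R (2 * R)‖ ^ 4 := by
          gcongr
          exact (le_abs_self _).trans (le_mul_of_one_le_right (abs_nonneg _) hn)
      _ ≤ (C₁ + |C₂|) * (n + 1 : ℕ) * ‖alphaPoly c R ρ‖ ^ 4 := by
          gcongr
          linarith

theorem eventually_modeSq_nonpos (k : ℝ) {Z : ℝ} (hZ : 0 < Z) :
    ∀ᶠ n in Filter.atTop, modeSq k Z n ≤ 0 := by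
  obtain ⟨N, hN⟩ := exists_nat_gt (|k| * Z / Real.pi)
  filter_upwards [Filter.eventually_ge_atTop N] with n hn
  rw [modeSq_eq, sub_nonpos]
  refine sq_le_sq.2 ?_
  refine le_trans ?_ (le_abs_self _)
  rw [div_lt_iff₀ Real.pi_pos] at hN
  unfold freq
  rw [le_div_iff₀ hZ]
  refine hN.le.trans ?_
  have : (N : ℝ) ≤ (n + 1 : ℕ) := by exact_mod_cast hn.trans (Nat.le_succ n)
  exact mul_le_mul_of_nonneg_right this Real.pi_pos.le

/-- Solvability of the Dirichlet problem for data with finite `H^{1/2}` norm. -/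
theorem exists_solution {k c R ρ Z C : ℝ} (hc : 0 < c) (hR : 0 < R) (hρR : 2 * R ≤ ρ)
    (hZ : 0 < Z) (hκ : 0 < kappa k Z) (w p : ℕ → ℝ → ℂ)
    (hmode : ∀ n, ModeSystem c R (modeSq k Z n) (w n) (p n))
    (hw : ∀ n, w n R = 1) (hρ : ∀ n, w n ρ = 0) (hp : ∀ n, ‖p n R‖ ≤ C * (n + 1 : ℕ))
    {g : ℝ → ℂ} (hg : MemLp g 2 (volume.restrict (Ioo 0 Z)))
    (hsum : Summable fun n : ℕ => ((n + 1 : ℕ) : ℝ) * ‖sineCoeff Z (n + 1) g‖ ^ 2) :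
    ∃ W Wr Wz : ℝ × ℝ → ℂ, HasDirichletTrace R ρ Z W Wr Wz g ∧
      ∀ (V Vr Vz : ℝ × ℝ → ℂ) (h : ℝ → ℂ), HasDirichletTrace R ρ Z V Vr Vz h →
        HasSum (fun n => -(Z / 2 : ℂ) * (p n R * sineCoeff Z (n + 1) g
            * star (sineCoeff Z (n + 1) h)))
          (aPML k c R ρ Z W Wr Wz V Vr Vz) := by
  obtain ⟨K, hK0, hK⟩ := ModeSystem.exists_energy_bound hc hR hρR
  have hint : ∀ u : ℝ → ℝ, ∫ r in Ioo R ρ, u r = ∫ r in R..ρ, u r := fun u => by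
    rw [← integral_Ioc_eq_integral_Ioo, intervalIntegral.integral_of_le (by linarith)]
  have hfac : ∀ (b : ℂ) (u : ℝ → ℂ),
      ∫ r in Ioo R ρ, ‖b * u r‖ ^ 2 = ‖b‖ ^ 2 * ∫ r in R..ρ, ‖u r‖ ^ 2 := by
    intro b u
    rw [hint, ← intervalIntegral.integral_const_mul]
    congr 1; ext r; rw [norm_mul, mul_pow]
  have hw2 : ∀ n, modeSq k Z n ≤ 0 →
      kappa k Z ^ 2 * (∫ r in R..ρ, ‖w n r‖ ^ 2) ≤ K * (C * (n + 1 : ℕ)) := by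
    intro n hn
    have h1 := (hK _ _ _ (hmode n) hn (hw n) (hρ n)).2
    have h2 := kappa_sq_le k Z n
    rw [abs_of_nonpos hn] at h2
    have h3 : 0 ≤ ∫ r in R..ρ, ‖w n r‖ ^ 2 :=
      intervalIntegral.integral_nonneg (by linarith) fun r _ => by positivity
    calc _ ≤ -modeSq k Z n * ∫ r in R..ρ, ‖w n r‖ ^ 2 := by gcongr
      _ ≤ K * ‖p n R‖ := h1
      _ ≤ _ := by gcongr; exact hp n
  have hsummable : ∀ (u : ℕ → ℝ → ℂ) (M : ℝ),
      (∀ n, modeSq k Z n ≤ 0 → ∫ r in R..ρ, ‖u n r‖ ^ 2 ≤ M * (n + 1 : ℕ)) →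
      Summable fun n => ∫ r in Ioo R ρ, ‖sineCoeff Z (n + 1) g * u n r‖ ^ 2 := by
    intro u M hu
    refine (hsum.mul_left M).of_norm_bounded_eventually_nat ?_
    -- Only finitely many modes propagate, so the evanescent energy bound decides summability. Its
    -- growth, linear in m, matches the weight of the H^{1/2} norm.
    filter_upwards [eventually_modeSq_nonpos k hZ] with n hn
    rw [hfac, Real.norm_of_nonneg (mul_nonneg (sq_nonneg _)
      (intervalIntegral.integral_nonneg (by linarith) fun r _ => by positivity))]
    have := mul_le_mul_of_nonneg_left (hu n hn) (sq_nonneg ‖sineCoeff Z (n + 1) g‖)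
    linarith
  refine exists_modal_solution hc hR (by linarith) hZ w p hmode hw hρ hg
    (hsummable w (K * C / kappa k Z ^ 2) fun n hn => ?_)
    (hsummable (fun n r => alphaPoly c R r * stretchPoly c R r * p n r) (K * C) fun n hn => ?_)
    (hsummable (fun n r => freq Z n * w n r) (K * C + k ^ 2 * (K * C / kappa k Z ^ 2))
      fun n hn => ?_)
  · have h1 := hw2 n hn
    rw [mul_comm, ← le_div_iff₀ (by positivity)] at h1
    exact h1.trans (le_of_eq (by ring))
  · refine (hK _ _ _ (hmode n) hn (hw n) (hρ n)).1.trans ?_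
    rw [mul_assoc]
    gcongr
    exact hp n
  · have h1 := hw2 n hn
    rw [mul_comm, ← le_div_iff₀ (by positivity)] at h1
    have h2 := (hK _ _ _ (hmode n) hn (hw n) (hρ n)).2.trans
      (mul_le_mul_of_nonneg_left (hp n) hK0)
    -- The squared frequency is -q + k²: the first part is bounded by the energy estimate, the
    -- second by κ² ≤ -q.
    have e : ∫ r in R..ρ, ‖(freq Z n : ℂ) * w n r‖ ^ 2
        = (-modeSq k Z n) * (∫ r in R..ρ, ‖w n r‖ ^ 2) + k ^ 2 * ∫ r in R..ρ, ‖w n r‖ ^ 2 := by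
      rw [← add_mul, ← intervalIntegral.integral_const_mul]
      congr 1; ext r
      rw [norm_mul, mul_pow, Complex.norm_real, Real.norm_eq_abs, sq_abs, modeSq_eq]
      ring
    rw [e]
    have h3 := mul_le_mul_of_nonneg_left h1 (sq_nonneg k)
    refine (add_le_add h2 h3).trans (le_of_eq ?_)
    ring

/-! ### The operator on the trace space -/

/-- The weighted sine coefficients of an element of `H^{1/2}_0`. -/
def HHalf.seq {Z : ℝ} (η : HHalf Z) : lp (fun _ : ℕ => ℂ) 2 := SineHalf.toSeq Z (Subtype.val η)

namespace HHalf

variable {Z : ℝ}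

theorem norm_seq (η : HHalf Z) : ‖η.seq‖ = ‖η‖ := rfl

theorem seq_add (η ψ : HHalf Z) : (η + ψ).seq = η.seq + ψ.seq := map_add (SineHalf.toSeq Z) _ _

theorem seq_smul (a : ℂ) (η : HHalf Z) : (a • η).seq = a • η.seq :=
  map_smul (SineHalf.toSeq Z) _ _

theorem seq_apply (η : HHalf Z) (n : ℕ) :
    η.seq n = (Real.sqrt ((n + 1 : ℕ) : ℝ) : ℂ) * sineCoeff Z (n + 1) η.fn := rfl

theorem memLp_fn (η : HHalf Z) : MemLp η.fn 2 (volume.restrict (Ioo 0 Z)) := Lp.memLp _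

theorem summable_coeff (η : HHalf Z) :
    Summable fun n : ℕ => ((n + 1 : ℕ) : ℝ) * ‖sineCoeff Z (n + 1) η.fn‖ ^ 2 := by
  have h := (lp.memℓp η.seq).summable (by norm_num)
  refine h.congr fun n => ?_
  rw [seq_apply, norm_mul, Complex.norm_real, Real.norm_of_nonneg (Real.sqrt_nonneg _)]
  simp only [ENNReal.toReal_ofNat, Real.rpow_ofNat]
  rw [mul_pow, Real.sq_sqrt (by positivity)]

/-- The operator `H^{1/2}_0 → H^{-1/2}` which multiplies the weighted sine coefficients by a bounded
sequence. -/
theorem exists_multiplier (τ : ℕ → ℂ) {M : ℝ} (hM : 0 ≤ M) (hτ : ∀ n, ‖τ n‖ ≤ M) :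
    ∃ T : HHalf Z →L[ℂ] HNegHalf Z, ‖T‖ ≤ M ∧
      ∀ η ψ, HasSum (fun n => τ n * η.seq n * star (ψ.seq n)) (T η ψ) := by
  let D := lp.mapCLM (𝕜 := ℂ) (E := fun _ : ℕ => ℂ) (F := fun _ : ℕ => ℂ) 2
    (fun n => τ n • ContinuousLinearMap.id ℂ ℂ) hM
    (fun n => by
      refine ContinuousLinearMap.opNorm_le_bound _ hM fun x => ?_
      simp only [_root_.smul_apply, ContinuousLinearMap.id_apply, norm_smul]
      gcongr
      exact hτ n)
  have hD : ‖D‖ ≤ M := lp.norm_mapCLM_le _ _ _ _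
  have hDapp : ∀ x n, D x n = τ n * x n := fun x n => by simp [D]
  -- The ℓ² pairing of the weighted sequences: each carries √m, so a multiplier bounded on them acts
  -- on the plain coefficients with growth m.
  let B : HHalf Z →ₗ[ℂ] HHalf Z →ₛₗ[starRingEnd ℂ] ℂ :=
    LinearMap.mk₂'ₛₗ (RingHom.id ℂ) (starRingEnd ℂ) (fun η ψ => inner ℂ ψ.seq (D η.seq))
      (fun _ _ _ => by rw [seq_add, map_add, inner_add_right])
      (fun _ _ _ => by rw [seq_smul, map_smul, inner_smul_right]; rfl)
      (fun _ _ _ => by rw [seq_add, inner_add_left])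
      (fun _ _ _ => by rw [seq_smul, inner_smul_left]; rfl)
  have hB : ∀ η ψ, ‖B η ψ‖ ≤ M * ‖η‖ * ‖ψ‖ := by
    intro η ψ
    change ‖inner ℂ ψ.seq (D η.seq)‖ ≤ _
    refine (norm_inner_le_norm _ _).trans ?_
    rw [norm_seq, mul_comm]
    gcongr
    refine (D.le_opNorm _).trans ?_
    rw [norm_seq]
    gcongr
  refine ⟨B.mkContinuous₂ M hB, B.mkContinuous₂_norm_le hM hB, fun η ψ => ?_⟩
  rw [LinearMap.mkContinuous₂_apply]
  have h := lp.hasSum_inner (𝕜 := ℂ) ψ.seq (D η.seq)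
  have e : ∀ n, inner ℂ (ψ.seq n) (D η.seq n) = τ n * η.seq n * star (ψ.seq n) := fun n => by
    rw [hDapp, RCLike.inner_apply]; rfl
  simp only [e] at h
  exact h

end HHalf

end PML

end

/-! ### The Dirichlet-to-Neumann operator. -/

/-- The relation `ℓ = T̂ η` is the graph of a bounded linear operator `T̂` from `H^{1/2}_0` to
`H^{-1/2}` (so `T̂ η` exists and is unique), with the stated bound of its operator norm. -/
theorem mainTheorem3 (R Z k : ℝ) (hR : 0 < R) (hZ : 0 < Z) (hk : 0 < k)
    (hres : ∀ m : ℕ, 1 ≤ m → k ≠ m * Real.pi / Z) :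
    ∃ C : ℝ, 0 < C ∧ ∀ χ₀ ρ : ℝ, 0 < χ₀ → 2 * R ≤ ρ → 1 ≤ PML.kappa k Z * χ₀ * R →
      ∃ T : PML.HHalf Z →L[ℂ] PML.HNegHalf Z,
        (∀ (η : PML.HHalf Z) (ℓ : PML.HNegHalf Z), PML.IsPMLDtN k χ₀ R ρ Z η ℓ ↔ ℓ = T η) ∧
        ‖T‖ ≤ C * (ρ - R) ^ 6 * ‖PML.alpha χ₀ R ρ‖ ^ 4 * ‖PML.beta χ₀ R ρ‖ ^ 2 := by
  open PML in
  obtain ⟨C₁, hC₁, hbound⟩ := exists_mode_bound R Z k hR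
  -- Division by R⁶ compensates for the factor (ρ - R)⁶ ≥ R⁶ in the asserted bound.
  refine ⟨Z / 2 * (R ^ 2 * C₁ + 1) / R ^ 6, by positivity, fun c ρ hc hρR hκc => ?_⟩
  have hRρ : R < ρ := by linarith
  have hκ := kappa_pos hκc
  choose w p hmode hw hρ using fun n : ℕ =>
    ModeSystem.exists_dirichlet (c := c) (R := R) (modeSq k Z n) hc hR hRρ
  have hp : ∀ n, ‖p n R‖ ≤ C₁ * ‖alphaPoly c R ρ‖ ^ 4 * (n + 1 : ℕ) := fun n =>
    (hbound c ρ hc hρR hκc n _ _ (hmode n) (hw n) (hρ n)).trans (le_of_eq (by ring))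
  have ha1 : 1 ≤ ‖alphaPoly c R ρ‖ ^ 4 := one_le_pow₀ (one_le_norm_alphaPoly hc hRρ.le)
  set M := Z / 2 * (R ^ 2 * C₁ + 1) * ‖alphaPoly c R ρ‖ ^ 4 with hM
  -- The symbol of T̂ is R² p(R) - 1. The factor Z/2 comes from Parseval with the normalisation of
  -- `sineCoeff`, and the division by m = n + 1 cancels the two weights √m.
  obtain ⟨T, hT, hTs⟩ := HHalf.exists_multiplier (Z := Z)
    (fun n => (Z / 2 : ℂ) * ((R : ℂ) ^ 2 * p n R - 1) / ((n + 1 : ℕ) : ℂ)) (M := M)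
    (by positivity) (fun n => by
      have hn : (1 : ℝ) ≤ (n + 1 : ℕ) := by exact_mod_cast Nat.succ_le_succ (Nat.zero_le n)
      have hZn : ‖(Z / 2 : ℂ)‖ = Z / 2 := by
        rw [norm_div, Complex.norm_real, Real.norm_of_nonneg hZ.le]; simp
      rw [norm_div, norm_mul, hZn, Complex.norm_natCast, div_le_iff₀ (by positivity)]
      have h1 : ‖(R : ℂ) ^ 2 * p n R - 1‖ ≤ R ^ 2 * ‖p n R‖ + 1 := by
        refine (norm_sub_le _ _).trans (le_of_eq ?_)
        rw [norm_mul, norm_pow, Complex.norm_real, Real.norm_of_nonneg hR.le, norm_one]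
      have h2 : 1 ≤ ‖alphaPoly c R ρ‖ ^ 4 * (n + 1 : ℕ) := one_le_mul_of_one_le_of_one_le ha1 hn
      have h3 := mul_le_mul_of_nonneg_left (hp n) (sq_nonneg R)
      calc Z / 2 * ‖(R : ℂ) ^ 2 * p n R - 1‖
          ≤ Z / 2 * (R ^ 2 * (C₁ * ‖alphaPoly c R ρ‖ ^ 4 * (n + 1 : ℕ))
            + ‖alphaPoly c R ρ‖ ^ 4 * (n + 1 : ℕ)) := by gcongr; linarith
        _ = M * (n + 1 : ℕ) := by rw [hM]; ring)
  have hTval : ∀ (η ψ : HHalf Z) (a : ℂ),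
      HasSum (fun n => -(Z / 2 : ℂ) * (p n R * sineCoeff Z (n + 1) η.fn
        * star (sineCoeff Z (n + 1) ψ.fn))) a →
      T η ψ = -(R : ℂ) ^ 2 * a - ∫ z in Ioo 0 Z, η.fn z * star (ψ.fn z) := by
    intro η ψ a ha
    have h1 := hasSum_sineCoeff_mul hZ η.memLp_fn ψ.memLp_fn.star
    refine (hTs η ψ).unique (((ha.mul_left (-(R : ℂ) ^ 2)).sub h1).congr_fun fun n => ?_)
    have hs : (Real.sqrt ((n + 1 : ℕ) : ℝ) : ℂ) * (Real.sqrt ((n + 1 : ℕ) : ℝ) : ℂ)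
        = ((n + 1 : ℕ) : ℂ) := by
      rw [← Complex.ofReal_mul, Real.mul_self_sqrt (by positivity), Complex.ofReal_natCast]
    have hn : ((n + 1 : ℕ) : ℂ) ≠ 0 := by exact_mod_cast Nat.succ_ne_zero n
    have hc1 : star (Real.sqrt ((n + 1 : ℕ) : ℝ) : ℂ) = (Real.sqrt ((n + 1 : ℕ) : ℝ) : ℂ) :=
      Complex.conj_ofReal _
    have hc2 : sineCoeff Z (n + 1) (star ψ.fn) = star (sineCoeff Z (n + 1) ψ.fn) :=
      sineCoeff_star _ _
    rw [HHalf.seq_apply, HHalf.seq_apply, star_mul', hc1, hc2]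
    set s : ℂ := (Real.sqrt ((n + 1 : ℕ) : ℝ) : ℂ)
    set N : ℂ := ((n + 1 : ℕ) : ℂ)
    have e : (Z / 2 : ℂ) * ((R : ℂ) ^ 2 * p n R - 1) / N * (s * sineCoeff Z (n + 1) η.fn)
        * (s * star (sineCoeff Z (n + 1) ψ.fn)) = (Z / 2 : ℂ) * ((R : ℂ) ^ 2 * p n R - 1)
          * sineCoeff Z (n + 1) η.fn * star (sineCoeff Z (n + 1) ψ.fn) * ((s * s) / N) := by ring
    rw [e, hs, div_self hn]
    ring
  refine ⟨T, fun η ℓ => ⟨?_, ?_⟩, ?_⟩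
  · rintro ⟨W, Wr, Wz, hW, hℓ⟩
    ext ψ
    have hcs : ∀ n : ℕ, ‖sineCoeff Z (n + 1) fun z => star (ψ.fn z)‖
        = ‖sineCoeff Z (n + 1) ψ.fn‖ := fun n => by rw [sineCoeff_star, norm_star]
    -- V has data conj(ψ), so its conjugate is admissible in `IsNeumannTrace`. By symmetry the form
    -- of W against it equals that of V against conj(W), which the modal formula evaluates from the
    -- trace η of W alone. Hence ℓ does not depend on which solution W was given.
    obtain ⟨V, Vr, Vz, hV, hVa⟩ := exists_solution (g := fun z => star (ψ.fn z)) hc hR hρR hZ hκ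
      w p hmode hw hρ hp ψ.memLp_fn.star (by simpa only [hcs] using ψ.summable_coeff)
    have hVs := hV.star
    simp only [star_star] at hVs
    rw [hℓ ψ _ _ _ hVs, aPML_star_swap]
    have h1 := hVa _ _ _ _ hW.trace.star
    simp only [sineCoeff_star, star_star] at h1
    refine (hTval η ψ _ ?_).symm
    refine h1.congr_fun fun n => ?_
    ring
  · rintro rfl
    obtain ⟨W, Wr, Wz, hW, hWa⟩ := exists_solution hc hR hρR hZ hκ
      w p hmode hw hρ hp η.memLp_fn η.summable_coeff
    refine ⟨W, Wr, Wz, ⟨hW, fun v vr vz hv => ?_⟩, fun ψ Ψ Ψr Ψz hΨ => ?_⟩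
    · have h1 := hWa _ _ _ _ hv
      have h0 : ∀ n : ℕ, sineCoeff Z (n + 1) (fun _ => 0) = 0 := fun n => by simp [sineCoeff]
      simp only [h0, star_zero, mul_zero] at h1
      exact h1.unique hasSum_zero
    · exact hTval η ψ _ (hWa _ _ _ _ hΨ)
  · have hα : alpha c R ρ = alphaPoly c R ρ := alpha_eq hRρ
    have hβ : 1 ≤ ‖beta c R ρ‖ ^ 2 := by
      refine one_le_pow₀ ?_
      have hρ0 : 0 < ρ := by linarith
      rw [beta, stretch_eq hRρ, norm_div, Complex.norm_real, Real.norm_of_nonneg hρ0.le,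
        one_le_div hρ0]
      refine le_trans ?_ (Complex.re_le_norm _)
      rw [stretchPoly_re]
      have : 0 ≤ c * (ρ - R) ^ 2 := by positivity
      linarith
    have hd : R ^ 6 ≤ (ρ - R) ^ 6 := by gcongr; linarith
    rw [hα]
    refine hT.trans ?_
    calc M = Z / 2 * (R ^ 2 * C₁ + 1) / R ^ 6 * R ^ 6 * ‖alphaPoly c R ρ‖ ^ 4 * 1 := by
          rw [hM]; field_simp
      _ ≤ _ := by gcongr
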